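/- **Proposition (parallel complex structures on $TM$).** Let $M$ be a smooth manifold with an almost Norden structure: a smooth pseudo-Riemannian metric $g$ and a smooth almost complex structure $J$ (so $J^2=-\mathrm{Id}$) with $g(JX,JY)=-g(X,Y)$; then $g$ and the associated metric $\widetilde g=g(\cdot,J\cdot)$ have neutral signature. Let $\nabla$ be the Levi-Civita connection of $g$ and $R$ its curvature tensor. Call the base *flat* if $R=0$, and say that *$J$ is parallel* if $\nabla J=0$. For $u\in T_pM\subset TM$ and $X\in T_pM$ let $X^H,X^V\in T_u(TM)$ be the horizontal (with respect to $\nabla$) and the vertical lift of $X$. Define endomorphism fields $J_1,J_2,J_3$ and a metric $\widehat g$ (the complete lift of $g$) on $TM$ by $$J_1X^H=-(JX)^H,\quad J_1X^V=(JX)^V;\qquad J_2X^H=X^V,\quad J_2X^V=-X^H;\qquad J_3X^H=(JX)^V,\quad J_3X^V=(JX)^H;$$ $$\widehat g(X^H,Y^H)=\widehat g(X^V,Y^V)=0,\qquad \widehat g(X^H,Y^V)=\widehat g(X^V,Y^H)=g(X,Y).$$ Let $\widehat\nabla$ be the Levi-Civita connection of $\widehat g$, and put $H=(J_1,J_2,J_3)$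 and $\widehat G=(\widehat g,\widehat g(J_1\cdot,\cdot),\widehat g(J_2\cdot,\cdot),\widehat g(J_3\cdot,\cdot))$. A *complex structure* is an almost complex structure with vanishing Nijenhuis tensor. Then: 1. For $\alpha=1$ and for $\alpha=3$: $\widehat\nabla J_\alpha=0$ if and only if the base is flat and $J$ is parallel. Equivalently, $J_\alpha$ is a complex structure with $\widehat\nabla J_\alpha=0$ if and only if the base is flat and $J$ is parallel. 2. $\widehat\nabla J_2=0$ if and only if the base is flat. Equivalently, $J_2$ is a complex structure with $\widehat\nabla J_2=0$ if and only if the base is flat. 3. $(TM,H,\widehat G)$ is a pseudo-hyper-Kähler manifold if and only if the base is flat and $J$ is parallel. Here $(TM,H,\widehat G)$ is *pseudo-hyper-Kähler* if $J_1,J_2,J_3$ are pairwise anticommuting almost complex structures with $J_3=J_1J_2$, $\widehat g$ is a pseudo-Riemannian metric with $\widehat g(\cdot,\cdot)=\widehat g(J_1\cdot,J_1\cdot)=-\widehat g(J_2\cdot,J_2\cdot)=-\widehat g(J_3\cdot,J_3\cdot)$, and the tensors $F_\alpha(x,y,z)=\widehat g\big((\widehat\nabla_xJ_\alpha)y,z\big)$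 vanish for $\alpha=1,2,3$. -/

import Mathlib

open Bundle
open scoped Manifold ContDiff

noncomputable section

namespace NordenTangent

/-! ### Tensor fields and connections on a smooth manifold `N` -/

section General

variable {E : Type*} [NormedAddCommGroup E] [NormedSpace ℝ E]
  {H : Type*} [TopologicalSpace H] (I : ModelWithCorners ℝ E H)
  {N : Type*} [TopologicalSpace N] [ChartedSpace H N]

/-- A field of endomorphisms of the tangent spaces of `N`. -/
abbrev EndField (N : Type*) [TopologicalSpace N] [ChartedSpace H N] :=
  ∀ x : N, TangentSpace I x →L[ℝ] TangentSpace I x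

/-- A field of bilinear forms on the tangent spaces of `N`. -/
abbrev FormField (N : Type*) [TopologicalSpace N] [ChartedSpace H N] :=
  ∀ x : N, TangentSpace I x →L[ℝ] TangentSpace I x →L[ℝ] ℝ

/-- The underlying map of a connection on `TN`: `cov Y x v` is `(∇_v Y)(x)`. -/
abbrev Connection (N : Type*) [TopologicalSpace N] [ChartedSpace H N] :=
  (∀ x : N, TangentSpace I x) → ∀ x : N, TangentSpace I x →L[ℝ] TangentSpace I x

variable {I}

/-- `J` is an almost complex structure: a smooth `(1,1)`-tensor field with `J² = -1`. -/
structure IsAlmostComplex [IsManifold I ∞ N] (J : EndField I N) : Prop where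
  smooth : ContMDiff I (I.prod 𝓘(ℝ, E →L[ℝ] E)) ∞
    (fun x ↦ TotalSpace.mk' (E →L[ℝ] E)
      (E := fun x : N ↦ TangentSpace I x →L[ℝ] TangentSpace I x) x (J x))
  sq : ∀ (x : N) (v : TangentSpace I x), J x (J x v) = -v

/-- `g` is a pseudo-Riemannian metric: a smooth field of nondegenerate symmetric bilinear forms. -/
structure IsPseudoRiemannian [IsManifold I ∞ N] (g : FormField I N) : Prop where
  smooth : ContMDiff I (I.prod 𝓘(ℝ, E →L[ℝ] E →L[ℝ] ℝ)) ∞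
    (fun x ↦ TotalSpace.mk' (E →L[ℝ] E →L[ℝ] ℝ)
      (E := fun x : N ↦ TangentSpace I x →L[ℝ] TangentSpace I x →L[ℝ] ℝ) x (g x))
  symm : ∀ (x : N) (v w : TangentSpace I x), g x v w = g x w v
  nondegenerate : ∀ (x : N) (v : TangentSpace I x), (∀ w, g x v w = 0) → v = 0

/-- An almost Norden structure: an almost complex structure `J` acting as an anti-isometry of the
pseudo-Riemannian metric `g`. That `g` has neutral signature is a consequence, since `J` exchanges
`g` and `-g`. The associated metric is `g(·, J ·)`. -/
structure IsAlmostNorden [IsManifold I ∞ N] (J : EndField I N) (g : FormField I N) : Prop where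
  almostComplex : IsAlmostComplex J
  metric : IsPseudoRiemannian g
  anti_isometry : ∀ (x : N) (v w : TangentSpace I x), g x (J x v) (J x w) = -g x v w

/-- The covariant derivative `cov` is torsion-free and compatible with `g`. -/
structure IsLeviCivita [FiniteDimensional ℝ E] [IsManifold I ∞ N]
    (g : FormField I N) (cov : CovariantDerivative I E (TangentSpace I : N → Type _)) : Prop where
  torsion_free :
    haveI : CompleteSpace E := FiniteDimensional.complete ℝ E
    cov.torsion = 0
  metric : ∀ (x : N) (Y Z : ∀ x : N, TangentSpace I x),
    MDifferentiableAt I (I.prod 𝓘(ℝ, E)) (fun y ↦ TotalSpace.mk' E y (Y y)) x →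
    MDifferentiableAt I (I.prod 𝓘(ℝ, E)) (fun y ↦ TotalSpace.mk' E y (Z y)) x →
    ∀ v : TangentSpace I x,
      mvfderiv I (fun y ↦ g y (Y y) (Z y)) x v =
        g x (cov Y x v) (Z x) + g x (Y x) (cov Z x v)

open Classical in
/-- The Levi-Civita connection of `g`. It exists whenever `g` is a pseudo-Riemannian metric, and
its values on differentiable vector fields are then unique; the values on other fields, and the
value `0` given here when there is none, carry no information. -/
def leviCivita [FiniteDimensional ℝ E] [IsManifold I ∞ N]
    (g : FormField I N) : Connection I N :=
  if h : ∃ cov : CovariantDerivative I E (TangentSpace I : N → Type _), IsLeviCivita g cov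
  then h.choose.toFun else 0

/-- The curvature `R(X,Y)Z = ∇_X ∇_Y Z - ∇_Y ∇_X Z - ∇_{[X,Y]} Z`. -/
def curvature (cov : Connection I N) (X Y Z : ∀ x : N, TangentSpace I x) :
    ∀ x : N, TangentSpace I x :=
  fun x ↦ cov (fun y ↦ cov Z y (Y y)) x (X x) - cov (fun y ↦ cov Z y (X y)) x (Y x)
    - cov Z x (VectorField.mlieBracket I X Y x)

/-- The curvature tensor vanishes: `R(X,Y)Z = 0` at `x` for all `X`, `Y`, `Z` smooth near `x`. -/
def IsFlat [IsManifold I ∞ N] (cov : Connection I N) : Prop :=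
  ∀ (x : N) (X Y Z : ∀ x : N, TangentSpace I x),
    ContMDiffAt I (I.prod 𝓘(ℝ, E)) ∞ (fun y ↦ TotalSpace.mk' E y (X y)) x →
    ContMDiffAt I (I.prod 𝓘(ℝ, E)) ∞ (fun y ↦ TotalSpace.mk' E y (Y y)) x →
    ContMDiffAt I (I.prod 𝓘(ℝ, E)) ∞ (fun y ↦ TotalSpace.mk' E y (Z y)) x →
    curvature cov X Y Z x = 0

/-- `((∇_v J) Y)(x) = (∇_v (J Y))(x) - J (∇_v Y)(x)`. -/
def derivEnd (cov : Connection I N) (J : EndField I N) (x : N) (v : TangentSpace I x)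
    (Y : ∀ x : N, TangentSpace I x) : TangentSpace I x :=
  cov (fun y ↦ J y (Y y)) x v - J x (cov Y x v)

/-- `∇ J = 0`. -/
def IsParallel [IsManifold I ∞ N] (cov : Connection I N) (J : EndField I N) : Prop :=
  ∀ (x : N) (v : TangentSpace I x) (Y : ∀ x : N, TangentSpace I x),
    MDifferentiableAt I (I.prod 𝓘(ℝ, E)) (fun y ↦ TotalSpace.mk' E y (Y y)) x →
    derivEnd cov J x v Y = 0

/-- The Nijenhuis tensor `[X,Y] + J[JX,Y] + J[X,JY] - [JX,JY]`. -/
def nijenhuis (J : EndField I N) (X Y : ∀ x : N, TangentSpace I x) :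
    ∀ x : N, TangentSpace I x :=
  fun x ↦ VectorField.mlieBracket I X Y x
    + J x (VectorField.mlieBracket I (fun y ↦ J y (X y)) Y x)
    + J x (VectorField.mlieBracket I X (fun y ↦ J y (Y y)) x)
    - VectorField.mlieBracket I (fun y ↦ J y (X y)) (fun y ↦ J y (Y y)) x

/-- `J` is a complex structure: an almost complex structure with vanishing Nijenhuis tensor. -/
structure IsComplex [IsManifold I ∞ N] (J : EndField I N) : Prop where
  almostComplex : IsAlmostComplex J
  integrable : ∀ (x : N) (X Y : ∀ x : N, TangentSpace I x),
    MDifferentiableAt I (I.prod 𝓘(ℝ, E)) (fun y ↦ TotalSpace.mk' E y (X y)) x →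
    MDifferentiableAt I (I.prod 𝓘(ℝ, E)) (fun y ↦ TotalSpace.mk' E y (Y y)) x →
    nijenhuis J X Y x = 0

/-- An almost hypercomplex structure `(J₁, J₂, J₃)`: anticommuting almost complex structures with
`J₃ = J₁ ∘ J₂`. -/
structure IsAlmostHypercomplex [IsManifold I ∞ N] (J₁ J₂ J₃ : EndField I N) : Prop where
  almostComplex₁ : IsAlmostComplex J₁
  almostComplex₂ : IsAlmostComplex J₂
  almostComplex₃ : IsAlmostComplex J₃
  comp_eq : ∀ (x : N) (v : TangentSpace I x), J₃ x v = J₁ x (J₂ x v)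
  anticomm₁₂ : ∀ (x : N) (v : TangentSpace I x), J₁ x (J₂ x v) = -J₂ x (J₁ x v)
  anticomm₂₃ : ∀ (x : N) (v : TangentSpace I x), J₂ x (J₃ x v) = -J₃ x (J₂ x v)
  anticomm₃₁ : ∀ (x : N) (v : TangentSpace I x), J₃ x (J₁ x v) = -J₁ x (J₃ x v)

/-- An almost hypercomplex Hermitian-Norden structure:
`g = g(J₁·, J₁·) = -g(J₂·, J₂·) = -g(J₃·, J₃·)`. Neutral signature of `g` is a consequence, since
`J₂` exchanges `g` and `-g`. The further forms `g(J₁·, ·)`, `g(J₂·, ·)`, `g(J₃·, ·)` of the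
structure are determined by these data. -/
structure IsAlmostHypercomplexHermitianNorden [IsManifold I ∞ N] (J₁ J₂ J₃ : EndField I N)
    (g : FormField I N) : Prop where
  hypercomplex : IsAlmostHypercomplex J₁ J₂ J₃
  metric : IsPseudoRiemannian g
  hermitian₁ : ∀ (x : N) (v w : TangentSpace I x), g x (J₁ x v) (J₁ x w) = g x v w
  norden₂ : ∀ (x : N) (v w : TangentSpace I x), g x (J₂ x v) (J₂ x w) = -g x v w
  norden₃ : ∀ (x : N) (v w : TangentSpace I x), g x (J₃ x v) (J₃ x w) = -g x v w

/-- The structure tensor `F(v, Y, w) = g((∇_v J) Y, w)` vanishes, `∇` being the Levi-Civita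
connection of `g`. -/
def StructureTensorVanishes [FiniteDimensional ℝ E] [IsManifold I ∞ N]
    (g : FormField I N) (J : EndField I N) : Prop :=
  ∀ (x : N) (v w : TangentSpace I x) (Y : ∀ x : N, TangentSpace I x),
    MDifferentiableAt I (I.prod 𝓘(ℝ, E)) (fun y ↦ TotalSpace.mk' E y (Y y)) x →
    g x (derivEnd (leviCivita g) J x v Y) w = 0

/-- A pseudo-hyper-Kähler manifold: an almost hypercomplex Hermitian-Norden manifold all three of
whose structure tensors vanish. -/
structure IsPseudoHyperKahler [FiniteDimensional ℝ E] [IsManifold I ∞ N]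
    (J₁ J₂ J₃ : EndField I N) (g : FormField I N) : Prop where
  hermitianNorden : IsAlmostHypercomplexHermitianNorden J₁ J₂ J₃ g
  vanishes₁ : StructureTensorVanishes g J₁
  vanishes₂ : StructureTensorVanishes g J₂
  vanishes₃ : StructureTensorVanishes g J₃

end General

/-! ### Lifts to the tangent bundle -/

section Lifts

variable {E : Type*} [NormedAddCommGroup E] [NormedSpace ℝ E]
  {M : Type*} [TopologicalSpace M] [ChartedSpace E M] [IsManifold 𝓘(ℝ, E) ∞ M]

/-- The vertical lift `X ↦ X^V` from `T_p M` to `T_u(TM)`, where `u ∈ T_p M`: the derivative at `u`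
of the inclusion of the fibre `T_p M` into `TM`. -/
def verticalLift (u : TangentBundle 𝓘(ℝ, E) M) :
    TangentSpace 𝓘(ℝ, E) u.proj →L[ℝ] TangentSpace 𝓘(ℝ, E).tangent u :=
  let incl : E → TangentBundle 𝓘(ℝ, E) M := fun w ↦ TotalSpace.mk' E u.proj w
  mfderiv 𝓘(ℝ, E) 𝓘(ℝ, E).tangent incl (show E from u.snd)

/-- The horizontal lift `X ↦ X^H` from `T_p M` to `T_u(TM)`, where `u ∈ T_p M`:
`X^H = dσ_p(X) - (∇_X σ)^V` for a vector field `σ`, smooth near `p`, with `σ(p) = u`. -/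
def horizontalLift (cov : Connection 𝓘(ℝ, E) M) (u : TangentBundle 𝓘(ℝ, E) M) :
    TangentSpace 𝓘(ℝ, E) u.proj →L[ℝ] TangentSpace 𝓘(ℝ, E).tangent u :=
  let σ : ∀ x : M, TangentSpace 𝓘(ℝ, E) x := FiberBundle.extend E u.snd
  let dσ : TangentSpace 𝓘(ℝ, E) u.proj →L[ℝ] TangentSpace 𝓘(ℝ, E).tangent u :=
    mfderiv 𝓘(ℝ, E) 𝓘(ℝ, E).tangent
      (fun x ↦ (TotalSpace.mk' E x (σ x) : TangentBundle 𝓘(ℝ, E) M)) u.proj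
  dσ - (verticalLift u).comp (cov σ u.proj)

/-- The decomposition of `T_u(TM)` into horizontal and vertical parts, as the linear isomorphism
`(a, b) ↦ a^H + b^V` from `T_p M × T_p M`. -/
def liftSum (cov : Connection 𝓘(ℝ, E) M) (u : TangentBundle 𝓘(ℝ, E) M) :
    (TangentSpace 𝓘(ℝ, E) u.proj × TangentSpace 𝓘(ℝ, E) u.proj) →L[ℝ]
      TangentSpace 𝓘(ℝ, E).tangent u :=
  (horizontalLift cov u).coprod (verticalLift u)

/-- The horizontal and vertical parts `(a, b)` of a tangent vector `a^H + b^V` of `TM`. -/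
def parts (cov : Connection 𝓘(ℝ, E) M) (u : TangentBundle 𝓘(ℝ, E) M) :
    TangentSpace 𝓘(ℝ, E).tangent u →L[ℝ]
      (TangentSpace 𝓘(ℝ, E) u.proj × TangentSpace 𝓘(ℝ, E) u.proj) :=
  (liftSum cov u).inverse

/-- `J₁ : X^H ↦ -(J X)^H, X^V ↦ (J X)^V`. -/
def liftJ₁ (cov : Connection 𝓘(ℝ, E) M) (J : EndField 𝓘(ℝ, E) M) :
    EndField 𝓘(ℝ, E).tangent (TangentBundle 𝓘(ℝ, E) M) := fun u ↦
  ((-(horizontalLift cov u ∘L J u.proj)).coprod (verticalLift u ∘L J u.proj)) ∘L parts cov u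

/-- `J₂ : X^H ↦ X^V, X^V ↦ -X^H`. -/
def liftJ₂ (cov : Connection 𝓘(ℝ, E) M) :
    EndField 𝓘(ℝ, E).tangent (TangentBundle 𝓘(ℝ, E) M) := fun u ↦
  ((verticalLift u).coprod (-(horizontalLift cov u))) ∘L parts cov u

/-- `J₃ : X^H ↦ (J X)^V, X^V ↦ (J X)^H`. -/
def liftJ₃ (cov : Connection 𝓘(ℝ, E) M) (J : EndField 𝓘(ℝ, E) M) :
    EndField 𝓘(ℝ, E).tangent (TangentBundle 𝓘(ℝ, E) M) := fun u ↦
  ((verticalLift u ∘L J u.proj).coprod (horizontalLift cov u ∘L J u.proj)) ∘L parts cov u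

/-- The complete lift of `g`: `ĝ(X^H, Y^H) = ĝ(X^V, Y^V) = 0`,
`ĝ(X^H, Y^V) = ĝ(X^V, Y^H) = g(X, Y)`, with horizontal lifts taken for `cov`. -/
def completeLift (cov : Connection 𝓘(ℝ, E) M) (g : FormField 𝓘(ℝ, E) M) :
    FormField 𝓘(ℝ, E).tangent (TangentBundle 𝓘(ℝ, E) M) := fun u ↦
  let gp : E →L[ℝ] E →L[ℝ] ℝ := g u.proj
  let hor : E × E →L[ℝ] E := ContinuousLinearMap.fst ℝ _ _ ∘L parts cov u
  let ver : E × E →L[ℝ] E := ContinuousLinearMap.snd ℝ _ _ ∘L parts cov u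
  (gp.bilinearComp hor ver + gp.bilinearComp ver hor : E × E →L[ℝ] E × E →L[ℝ] ℝ)

/-! The lifts decompose `T_u(TM)`, and the endomorphisms act on lifts as announced. -/

theorem trivialization_fibreInclusion (p : M) (w : E) :
    (trivializationAt E (TangentSpace 𝓘(ℝ, E)) p
      (TotalSpace.mk' E p w : TangentBundle 𝓘(ℝ, E) M)).2 = w := by
  have := TangentBundle.continuousLinearMapAt_trivializationAt_eq_core (I := 𝓘(ℝ,E)) (mem_chart_source E p)
  have h2 := (tangentBundleCore 𝓘(ℝ, E) M).coordChange_self (achart E p) p (by simp) w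
  exact h2

theorem mdifferentiableAt_fibreInclusion (p : M) (w : E) : MDifferentiableAt 𝓘(ℝ, E) 𝓘(ℝ, E).tangent
    (fun w : E ↦ (TotalSpace.mk' E p w : TangentBundle 𝓘(ℝ, E) M)) w := by
  have := mdifferentiableAt_totalSpace (IM := 𝓘(ℝ,E)) (IB := 𝓘(ℝ,E)) (F := E) (fun w : E ↦ (TotalSpace.mk' E p w : TangentBundle 𝓘(ℝ, E) M)) (x₀ := w)
  refine this.2 ?_
  refine ⟨mdifferentiableAt_const, ?_⟩
  simp only [trivialization_fibreInclusion]
  exact mdifferentiableAt_id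

theorem mdifferentiableAt_tangentProj (u : TangentBundle 𝓘(ℝ, E) M) : MDifferentiableAt 𝓘(ℝ, E).tangent 𝓘(ℝ, E)
    (TotalSpace.proj : TangentBundle 𝓘(ℝ, E) M → M) u :=
  Bundle.mdifferentiableAt_proj _

theorem mfderiv_proj_verticalLift (u : TangentBundle 𝓘(ℝ, E) M) (w) :
    mfderiv 𝓘(ℝ, E).tangent 𝓘(ℝ, E) (TotalSpace.proj : TangentBundle 𝓘(ℝ, E) M → M) u
      (verticalLift u w) = 0 := by
  have := mfderiv_comp (I := 𝓘(ℝ,E)) (M := E) (f := (fun w : E ↦ (TotalSpace.mk' E u.proj w : TangentBundle 𝓘(ℝ, E) M))) (show E from u.snd) (by exact mdifferentiableAt_tangentProj u) (mdifferentiableAt_fibreInclusion u.proj (show E from u.snd))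
  have h3 : (TotalSpace.proj : TangentBundle 𝓘(ℝ, E) M → M) ∘ (fun w : E ↦ (TotalSpace.mk' E u.proj w : TangentBundle 𝓘(ℝ, E) M)) = fun _ => u.proj := rfl
  rw [h3, mfderiv_const] at this
  exact (congrArg (fun L => L w) this).symm

theorem mfderiv_proj_horizontalLift (cov) (u : TangentBundle 𝓘(ℝ, E) M) (w) :
    mfderiv 𝓘(ℝ, E).tangent 𝓘(ℝ, E) (TotalSpace.proj : TangentBundle 𝓘(ℝ, E) M → M) u
      (horizontalLift cov u w) = w := by
  unfold horizontalLift
  have hs : MDifferentiableAt 𝓘(ℝ, E) 𝓘(ℝ, E).tangent  (fun x ↦ (TotalSpace.mk' E x (FiberBundle.extend E u.snd x) : TangentBundle 𝓘(ℝ, E) M)) u.proj := FiberBundle.mdifferentiableAt_extend ..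
  have hu : (TotalSpace.mk' E u.proj (FiberBundle.extend E u.snd u.proj) : TangentBundle 𝓘(ℝ, E) M) = u := by
    simp
  have := mfderiv_comp (I := 𝓘(ℝ,E)) (g := (TotalSpace.proj : TangentBundle 𝓘(ℝ, E) M → M)) u.proj (mdifferentiableAt_tangentProj _) hs
  have h3 : (TotalSpace.proj : TangentBundle 𝓘(ℝ, E) M → M) ∘ (fun x ↦ (TotalSpace.mk' E x (FiberBundle.extend E u.snd x) : TangentBundle 𝓘(ℝ, E) M)) = id := rfl
  rw [h3, mfderiv_id] at this
  have h4 := congrArg (fun L => L w) this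
  refine (map_sub _ _ _).trans ?_
  refine (congrArg₂ (· - ·) ?_ (mfderiv_proj_verticalLift u (cov (FiberBundle.extend E u.snd) u.proj w))).trans (sub_zero _)
  refine Eq.trans ?_ h4.symm
  let X : E × E := mfderiv 𝓘(ℝ, E) 𝓘(ℝ, E).tangent (fun x ↦
    (TotalSpace.mk' E x (FiberBundle.extend E u.snd x) : TangentBundle 𝓘(ℝ, E) M)) u.proj w
  let P : TangentBundle 𝓘(ℝ, E) M → E × E → E := fun q ↦
    mfderiv 𝓘(ℝ, E).tangent 𝓘(ℝ, E) (TotalSpace.proj : TangentBundle 𝓘(ℝ, E) M → M) q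
  exact congrArg (fun q ↦ P q X) hu.symm

theorem verticalLift_injective (u : TangentBundle 𝓘(ℝ, E) M) : Function.Injective (verticalLift u) := by
  have hd : MDifferentiableAt 𝓘(ℝ, E).tangent 𝓘(ℝ, E) (fun v : TangentBundle 𝓘(ℝ, E) M ↦ (trivializationAt E (TangentSpace 𝓘(ℝ, E)) u.proj v).2) u := by
    have := (mdifferentiableAt_totalSpace (IM := 𝓘(ℝ,E).tangent) (IB := 𝓘(ℝ,E)) (F := E) (fun v : TangentBundle 𝓘(ℝ, E) M ↦ v) (x₀ := u)).1 mdifferentiableAt_id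
    exact this.2
  have := mfderiv_comp (I := 𝓘(ℝ,E)) (M := E) (f := (fun w : E ↦ (TotalSpace.mk' E u.proj w : TangentBundle 𝓘(ℝ, E) M))) (show E from u.snd) (by exact hd) (mdifferentiableAt_fibreInclusion u.proj (show E from u.snd))
  have h3 : (fun v : TangentBundle 𝓘(ℝ, E) M ↦ (trivializationAt E (TangentSpace 𝓘(ℝ, E)) u.proj v).2) ∘ (fun w : E ↦ (TotalSpace.mk' E u.proj w : TangentBundle 𝓘(ℝ, E) M)) = id := by
    funext w; exact trivialization_fibreInclusion _ _
  rw [h3, mfderiv_id] at this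
  intro a b hab
  have ha := congrArg (fun L => L a) this
  have hb := congrArg (fun L => L b) this
  refine ha.trans (Eq.trans ?_ hb.symm)
  exact congrArg (mfderiv _ _ _ _) hab

theorem liftSum_isInvertible [FiniteDimensional ℝ E] (cov) (u : TangentBundle 𝓘(ℝ, E) M) :
    (liftSum cov u).IsInvertible := by
  let L : E × E →ₗ[ℝ] E × E :=
    { toFun := liftSum cov u, map_add' := (liftSum cov u).map_add,
      map_smul' := (liftSum cov u).map_smul }
  have key : ∀ a b : TangentSpace 𝓘(ℝ, E) u.proj,
      horizontalLift cov u a + verticalLift u b = 0 → a = 0 ∧ b = 0 := by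
    intro a b h
    have ha : a = 0 := by
      have := congrArg (mfderiv 𝓘(ℝ, E).tangent 𝓘(ℝ, E)
        (TotalSpace.proj : TangentBundle 𝓘(ℝ, E) M → M) u) h
      rw [map_add, mfderiv_proj_horizontalLift, mfderiv_proj_verticalLift, map_zero, add_zero] at this
      exact this
    subst ha
    rw [map_zero, zero_add] at h
    exact ⟨rfl, verticalLift_injective u (h.trans (map_zero _).symm)⟩
  have hinj : Function.Injective L := by
    refine (injective_iff_map_eq_zero L).2 ?_
    rintro ⟨a, b⟩ h
    exact Prod.ext (key a b h).1 (key a b h).2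
  exact ⟨(LinearEquiv.ofInjectiveEndo L hinj).toContinuousLinearEquiv (E := E × E) (F := E × E),
    ContinuousLinearMap.ext fun _ ↦ rfl⟩

theorem parts_horizontal [FiniteDimensional ℝ E] (cov) (u : TangentBundle 𝓘(ℝ, E) M) (a) :
    parts cov u (horizontalLift cov u a) = (a, 0) := by
  have := (liftSum_isInvertible cov u).inverse_apply_eq (x := (a,0)) (y := horizontalLift cov u a)
  refine this.2 ?_
  change _ = horizontalLift cov u a + verticalLift u 0
  rw [map_zero, add_zero]

theorem parts_vertical [FiniteDimensional ℝ E] (cov) (u : TangentBundle 𝓘(ℝ, E) M) (b) :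
    parts cov u (verticalLift u b) = (0, b) := by
  have := (liftSum_isInvertible cov u).inverse_apply_eq (x := (0,b)) (y := verticalLift u b)
  refine this.2 ?_
  change _ = horizontalLift cov u 0 + verticalLift u b
  rw [map_zero, zero_add]

theorem liftJ₁_horizontal [FiniteDimensional ℝ E] (cov) (J) (u : TangentBundle 𝓘(ℝ, E) M) (a) :
    liftJ₁ cov J u (horizontalLift cov u a) = -horizontalLift cov u (J u.proj a) := by
  change (ContinuousLinearMap.coprod _ _) (parts cov u (horizontalLift cov u a)) = _
  rw [parts_horizontal]; simp

theorem liftJ₁_vertical [FiniteDimensional ℝ E] (cov) (J) (u : TangentBundle 𝓘(ℝ, E) M) (a) :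
    liftJ₁ cov J u (verticalLift u a) = verticalLift u (J u.proj a) := by
  change (ContinuousLinearMap.coprod _ _) (parts cov u (verticalLift u a)) = _
  rw [parts_vertical]; simp

theorem liftJ₂_horizontal [FiniteDimensional ℝ E] (cov) (u : TangentBundle 𝓘(ℝ, E) M) (a) :
    liftJ₂ cov u (horizontalLift cov u a) = verticalLift u a := by
  change (ContinuousLinearMap.coprod _ _) (parts cov u (horizontalLift cov u a)) = _
  rw [parts_horizontal]; simp

theorem liftJ₂_vertical [FiniteDimensional ℝ E] (cov) (u : TangentBundle 𝓘(ℝ, E) M) (a) :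
    liftJ₂ cov u (verticalLift u a) = -horizontalLift cov u a := by
  change (ContinuousLinearMap.coprod _ _) (parts cov u (verticalLift u a)) = _
  rw [parts_vertical]; simp

theorem liftJ₃_horizontal [FiniteDimensional ℝ E] (cov) (J) (u : TangentBundle 𝓘(ℝ, E) M) (a) :
    liftJ₃ cov J u (horizontalLift cov u a) = verticalLift u (J u.proj a) := by
  change (ContinuousLinearMap.coprod _ _) (parts cov u (horizontalLift cov u a)) = _
  rw [parts_horizontal]; simp

theorem liftJ₃_vertical [FiniteDimensional ℝ E] (cov) (J) (u : TangentBundle 𝓘(ℝ, E) M) (a) :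
    liftJ₃ cov J u (verticalLift u a) = horizontalLift cov u (J u.proj a) := by
  change (ContinuousLinearMap.coprod _ _) (parts cov u (verticalLift u a)) = _
  rw [parts_vertical]; simp

theorem completeLift_apply (cov) (g) (u : TangentBundle 𝓘(ℝ, E) M)
    (v w : TangentSpace 𝓘(ℝ, E).tangent u) :
    completeLift cov g u v w =
      g u.proj (parts cov u v).1 (parts cov u w).2 +
        g u.proj (parts cov u v).2 (parts cov u w).1 := rfl

end Lifts

end NordenTangent

end

/-! In a chart of $M$ and the induced chart of $TM$, write a point of $TM$ as $(z,w)$. The Koszul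
formula identifies the Levi-Civita connection of $g$ with Christoffel symbols $\Gamma$, so flatness
and $\nabla J=0$ become pointwise identities in $\Gamma$ and the matrix of $J$ (`isFlat_iff_coord`,
`isParallel_iff_coord`). Metric compatibility gives $\widehat g(V,W)=\partial_w
g(V_1,W_1)+g(V_1,W_2)+g(V_2,W_1)$ (`repForm_completeLift`). Differentiating that compatibility once
more along $w$ shows that the symbols of $\widehat\nabla$ are $\Gamma$ together with
$\partial_w\Gamma$ (`isChristoffel_lift`).

Rewritten in horizontal and vertical parts $(a,b)$, a tangent vector with horizontal part $c$ acts
through the connection form $(a,b)\mapsto(\Gamma(c,a),\Gamma(c,b)+R(u,c)a)$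
(`coordParts_liftChristoffel`). Thus $\widehat\nabla$ is two copies of $\nabla$ plus the nilpotent
term $N_c(a,b)=(0,R(u,c)a)$. For a field with matrix $S$ in this frame, $\widehat\nabla_c$ of the
field is therefore the derivative of $S$ coming from $\nabla$, plus the commutator $[N_c,S]$
(`coordParts_coordDerivEnd`). With $R=R(u,c)$, the three matrices give: $J_1$: $\nabla J=0$ and
$RJ+JR=0$; $J_2$: $R=0$; $J_3$: $\nabla J=0$, $JR=0$ and $RJ=0$.

As $u$ runs over the whole fibre, a condition on $R(u,c)$ is a condition on the whole curvature
tensor. For $J_2$ and $J_3$ flatness is then immediate, $J$ being invertible. For $J_1$, the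
identity $\nabla J=0$ forces $R$ to commute with $J$ (`coordCurvature_comm`), hence $2JR=0$ and
again $R=0$.

The remaining assertions follow. A parallel almost complex structure of a torsion-free connection is
integrable (`isComplex_of_isParallel`), so requiring a complex structure adds nothing. The algebraic
part of the pseudo-hyper-Kähler condition holds for every almost Norden base
(`isAlmostHypercomplexHermitianNorden_lift`), and $F_\alpha=0$ means $\widehat\nabla J_\alpha=0$ by
nondegeneracy of $\widehat g$ (`structureTensorVanishes_iff`). -/

noncomputable section

namespace NordenTangent

open scoped Topology

set_option linter.unusedSectionVars false
set_option maxSynthPendingDepth 3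

/-! ### Vector fields, their derivatives and Lie brackets in a chart. -/

section Coordinates

variable {F : Type*} [NormedAddCommGroup F] [NormedSpace ℝ F]
  {H : Type*} [TopologicalSpace H] {I : ModelWithCorners ℝ F H}
  {N : Type*} [TopologicalSpace N] [ChartedSpace H N] [IsManifold I ∞ N]
  {G : Type*} [NormedAddCommGroup G] [NormedSpace ℝ G] {x₀ x : N} {n : ℕ∞}

/-- The differential at `x` of the chart at `x₀`. -/
def coord (I : ModelWithCorners ℝ F H) [IsManifold I ∞ N] (x₀ x : N) : TangentSpace I x →L[ℝ] F :=
  (trivializationAt F (TangentSpace I) x₀).continuousLinearMapAt ℝ x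

/-- The inverse of the differential at `x` of the chart at `x₀`. -/
def coordSymm (I : ModelWithCorners ℝ F H) [IsManifold I ∞ N] (x₀ x : N) :
    F →L[ℝ] TangentSpace I x :=
  (trivializationAt F (TangentSpace I) x₀).symmL ℝ x

theorem coord_coordSymm (hx : x ∈ (chartAt H x₀).source) (v : F) :
    coord I x₀ x (coordSymm I x₀ x v) = v :=
  (trivializationAt F (TangentSpace I) x₀).continuousLinearMapAt_symmL hx v

theorem coordSymm_coord (hx : x ∈ (chartAt H x₀).source) (v : TangentSpace I x) :
    coordSymm I x₀ x (coord I x₀ x v) = v :=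
  (trivializationAt F (TangentSpace I) x₀).symmL_continuousLinearMapAt hx v

theorem coord_injective (hx : x ∈ (chartAt H x₀).source) :
    Function.Injective (coord I x₀ x) :=
  Function.LeftInverse.injective (coordSymm_coord hx)

theorem coord_eq_mfderiv (hx : x ∈ (chartAt H x₀).source) :
    coord I x₀ x = mfderiv I 𝓘(ℝ, F) (extChartAt I x₀) x :=
  TangentBundle.continuousLinearMapAt_trivializationAt hx

theorem trivializationAt_snd (hx : x ∈ (chartAt H x₀).source) (v : TangentSpace I x) :
    (trivializationAt F (TangentSpace I) x₀ (TotalSpace.mk' F x v)).2 = coord I x₀ x v :=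
  ((trivializationAt F (TangentSpace I) x₀).continuousLinearMapAt_apply_of_mem ℝ hx v).symm

theorem trivializationAt_snd_eventually (hx : x ∈ (chartAt H x₀).source)
    (Y : ∀ x : N, TangentSpace I x) :
    (fun y ↦ (trivializationAt F (TangentSpace I) x₀ (TotalSpace.mk' F y (Y y))).2) =ᶠ[𝓝 x]
      fun y ↦ coord I x₀ y (Y y) := by
  filter_upwards [(chartAt H x₀).open_source.mem_nhds hx] with y hy
  exact trivializationAt_snd hy _

theorem contMDiffAt_coord_iff (hx : x ∈ (chartAt H x₀).source) {Y : ∀ x : N, TangentSpace I x} :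
    ContMDiffAt I (I.prod 𝓘(ℝ, F)) n (fun y ↦ TotalSpace.mk' F y (Y y)) x ↔
      ContMDiffAt I 𝓘(ℝ, F) n (fun y ↦ coord I x₀ y (Y y)) x := by
  have : IsManifold I (n + 1) N := .of_le (n := ∞) (by exact_mod_cast le_top)
  have := TangentBundle.contMDiffVectorBundle (I := I) (M := N) (n := n)
  rw [(trivializationAt F (TangentSpace I) x₀).contMDiffAt_section_iff hx]
  exact (trivializationAt_snd_eventually hx Y).contMDiffAt_iff

theorem mdifferentiableAt_coord_iff (hx : x ∈ (chartAt H x₀).source)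
    {Y : ∀ x : N, TangentSpace I x} :
    MDifferentiableAt I (I.prod 𝓘(ℝ, F)) (fun y ↦ TotalSpace.mk' F y (Y y)) x ↔
      MDifferentiableAt I 𝓘(ℝ, F) (fun y ↦ coord I x₀ y (Y y)) x := by
  rw [(trivializationAt F (TangentSpace I) x₀).mdifferentiableAt_section_iff I Y hx]
  exact (trivializationAt_snd_eventually hx Y).mdifferentiableAt_iff

variable [I.Boundaryless]

theorem extChartAt_symm_source {z : F} (hz : z ∈ (extChartAt I x₀).target) :
    (extChartAt I x₀).symm z ∈ (chartAt H x₀).source := by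
  rw [← extChartAt_source I]; exact (extChartAt I x₀).map_target hz

theorem extChartAt_mem_target (hx : x ∈ (chartAt H x₀).source) :
    extChartAt I x₀ x ∈ (extChartAt I x₀).target := by
  rw [← extChartAt_source I] at hx; exact (extChartAt I x₀).map_source hx

theorem extChartAt_symm_extChartAt (hx : x ∈ (chartAt H x₀).source) :
    (extChartAt I x₀).symm (extChartAt I x₀ x) = x := by
  rw [← extChartAt_source I] at hx; exact (extChartAt I x₀).left_inv hx

theorem contMDiffAt_chart_symm {z : F} (hz : z ∈ (extChartAt I x₀).target) :
    ContMDiffAt 𝓘(ℝ, F) I ∞ (extChartAt I x₀).symm z :=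
  (contMDiffOn_extChartAt_symm x₀).contMDiffAt ((isOpen_extChartAt_target x₀).mem_nhds hz)

theorem contMDiffAt_chart (hx : x ∈ (chartAt H x₀).source) :
    ContMDiffAt I 𝓘(ℝ, F) ∞ (extChartAt I x₀) x :=
  contMDiffAt_extChartAt' hx

theorem contDiffAt_comp_chart_symm (hx : x ∈ (chartAt H x₀).source) {f : N → G}
    (hf : ContMDiffAt I 𝓘(ℝ, G) n f x) :
    ContDiffAt ℝ n (fun z ↦ f ((extChartAt I x₀).symm z)) (extChartAt I x₀ x) := by
  rw [← contMDiffAt_iff_contDiffAt]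
  refine ContMDiffAt.comp (I' := I) (g := f) _ ?_
    ((contMDiffAt_chart_symm (extChartAt_mem_target hx)).of_le (by exact_mod_cast le_top))
  rwa [extChartAt_symm_extChartAt hx]

theorem differentiableAt_comp_chart_symm (hx : x ∈ (chartAt H x₀).source) {f : N → G}
    (hf : MDifferentiableAt I 𝓘(ℝ, G) f x) :
    DifferentiableAt ℝ (fun z ↦ f ((extChartAt I x₀).symm z)) (extChartAt I x₀ x) := by
  rw [← mdifferentiableAt_iff_differentiableAt]
  refine MDifferentiableAt.comp (I' := I) (g := f) _ ?_
    ((contMDiffAt_chart_symm (extChartAt_mem_target hx)).mdifferentiableAt (by simp))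
  rwa [extChartAt_symm_extChartAt hx]

theorem contMDiffAt_comp_chart (hx : x ∈ (chartAt H x₀).source) {f : F → G}
    (hf : ContDiffAt ℝ n f (extChartAt I x₀ x)) :
    ContMDiffAt I 𝓘(ℝ, G) n (fun y ↦ f (extChartAt I x₀ y)) x :=
  ContMDiffAt.comp (I' := 𝓘(ℝ, F)) (g := f) _ hf.contMDiffAt
    ((contMDiffAt_chart hx).of_le (by exact_mod_cast le_top))

theorem mdifferentiableAt_comp_chart (hx : x ∈ (chartAt H x₀).source) {f : F → G}
    (hf : DifferentiableAt ℝ f (extChartAt I x₀ x)) :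
    MDifferentiableAt I 𝓘(ℝ, G) (fun y ↦ f (extChartAt I x₀ y)) x :=
  MDifferentiableAt.comp (I' := 𝓘(ℝ, F)) (g := f) _ hf.mdifferentiableAt
    ((contMDiffAt_chart hx).mdifferentiableAt (by simp))

/-- The derivative of a function, computed in the chart at `x₀`. -/
theorem mvfderiv_eq_fderiv (hx : x ∈ (chartAt H x₀).source) {f : N → G}
    (hf : MDifferentiableAt I 𝓘(ℝ, G) f x) (v : TangentSpace I x) :
    mvfderiv I f x v =
      fderiv ℝ (fun z ↦ f ((extChartAt I x₀).symm z)) (extChartAt I x₀ x) (coord I x₀ x v) := by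
  have hd := differentiableAt_comp_chart_symm hx hf
  have h := mfderiv_comp (I' := 𝓘(ℝ, F)) (I'' := 𝓘(ℝ, G)) x hd.mdifferentiableAt
    ((contMDiffAt_chart (I := I) hx).mdifferentiableAt (by simp))
  have he : (fun z ↦ f ((extChartAt I x₀).symm z)) ∘ extChartAt I x₀ =ᶠ[𝓝 x] f := by
    filter_upwards [(chartAt H x₀).open_source.mem_nhds hx] with y hy
    simp only [Function.comp_apply, extChartAt_symm_extChartAt hy]
  rw [he.mfderiv_eq, mfderiv_eq_fderiv] at h
  rw [coord_eq_mfderiv hx]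
  exact congrArg (fun L => L v) h

/-- The coordinate expression of a vector field in the chart at `x₀`. -/
def repField (x₀ : N) (Y : ∀ x : N, TangentSpace I x) (z : F) : F :=
  coord I x₀ ((extChartAt I x₀).symm z) (Y ((extChartAt I x₀).symm z))

/-- The vector field with a given coordinate expression in the chart at `x₀`. -/
def ofRepField (I : ModelWithCorners ℝ F H) [IsManifold I ∞ N] (x₀ : N) (W : F → F) (x : N) :
    TangentSpace I x :=
  coordSymm I x₀ x (W (extChartAt I x₀ x))

theorem repField_chart (hx : x ∈ (chartAt H x₀).source) (Y : ∀ x : N, TangentSpace I x) :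
    repField x₀ Y (extChartAt I x₀ x) = coord I x₀ x (Y x) := by
  rw [repField, extChartAt_symm_extChartAt hx]

theorem repField_ofRepField {z : F} (hz : z ∈ (extChartAt I x₀).target) (W : F → F) :
    repField x₀ (ofRepField I x₀ W) z = W z := by
  rw [repField, ofRepField, coord_coordSymm (extChartAt_symm_source hz),
    (extChartAt I x₀).right_inv hz]

theorem contDiffAt_repField (hx : x ∈ (chartAt H x₀).source) {Y : ∀ x : N, TangentSpace I x}
    (hY : ContMDiffAt I (I.prod 𝓘(ℝ, F)) n (fun y ↦ TotalSpace.mk' F y (Y y)) x) :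
    ContDiffAt ℝ n (repField x₀ Y) (extChartAt I x₀ x) :=
  contDiffAt_comp_chart_symm hx ((contMDiffAt_coord_iff hx).1 hY)

theorem differentiableAt_repField (hx : x ∈ (chartAt H x₀).source)
    {Y : ∀ x : N, TangentSpace I x}
    (hY : MDifferentiableAt I (I.prod 𝓘(ℝ, F)) (fun y ↦ TotalSpace.mk' F y (Y y)) x) :
    DifferentiableAt ℝ (repField x₀ Y) (extChartAt I x₀ x) :=
  differentiableAt_comp_chart_symm hx ((mdifferentiableAt_coord_iff hx).1 hY)

theorem contMDiffAt_of_coord (hx : x ∈ (chartAt H x₀).source) {Y : ∀ x : N, TangentSpace I x}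
    {W : F → F} (hW : ContDiffAt ℝ n W (extChartAt I x₀ x))
    (hYW : ∀ᶠ y in 𝓝 x, coord I x₀ y (Y y) = W (extChartAt I x₀ y)) :
    ContMDiffAt I (I.prod 𝓘(ℝ, F)) n (fun y ↦ TotalSpace.mk' F y (Y y)) x :=
  (contMDiffAt_coord_iff hx).2 ((contMDiffAt_comp_chart hx hW).congr_of_eventuallyEq hYW)

theorem mdifferentiableAt_of_coord (hx : x ∈ (chartAt H x₀).source)
    {Y : ∀ x : N, TangentSpace I x}
    {W : F → F} (hW : DifferentiableAt ℝ W (extChartAt I x₀ x))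
    (hYW : ∀ᶠ y in 𝓝 x, coord I x₀ y (Y y) = W (extChartAt I x₀ y)) :
    MDifferentiableAt I (I.prod 𝓘(ℝ, F)) (fun y ↦ TotalSpace.mk' F y (Y y)) x :=
  (mdifferentiableAt_coord_iff hx).2 ((mdifferentiableAt_comp_chart hx hW).congr_of_eventuallyEq hYW)

theorem coord_ofRepField_eventually (hx : x ∈ (chartAt H x₀).source) (W : F → F) :
    ∀ᶠ y in 𝓝 x, coord I x₀ y (ofRepField I x₀ W y) = W (extChartAt I x₀ y) := by
  filter_upwards [(chartAt H x₀).open_source.mem_nhds hx] with y hy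
  exact coord_coordSymm hy _

theorem contMDiffAt_ofRepField (hx : x ∈ (chartAt H x₀).source) {W : F → F}
    (hW : ContDiffAt ℝ n W (extChartAt I x₀ x)) :
    ContMDiffAt I (I.prod 𝓘(ℝ, F)) n (fun y ↦ TotalSpace.mk' F y (ofRepField I x₀ W y)) x :=
  contMDiffAt_of_coord hx hW (coord_ofRepField_eventually hx W)

theorem mdifferentiableAt_ofRepField (hx : x ∈ (chartAt H x₀).source) {W : F → F}
    (hW : DifferentiableAt ℝ W (extChartAt I x₀ x)) :
    MDifferentiableAt I (I.prod 𝓘(ℝ, F)) (fun y ↦ TotalSpace.mk' F y (ofRepField I x₀ W y)) x :=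
  mdifferentiableAt_of_coord hx hW (coord_ofRepField_eventually hx W)

/-- Pullback of vector fields is defined through `ContinuousLinearMap.inverse`; this evaluates it
for a chart. -/
theorem mfderiv_chart_inverse (hx : x ∈ (chartAt H x₀).source) (v : F) :
    (mfderiv I 𝓘(ℝ, F) (extChartAt I x₀) x).inverse v = coordSymm I x₀ x v := by
  let e : TangentSpace I x ≃L[ℝ] F := ContinuousLinearEquiv.equivOfInverse (coord I x₀ x)
    (coordSymm I x₀ x) (coordSymm_coord hx) (coord_coordSymm hx)
  have h : mfderiv I 𝓘(ℝ, F) (extChartAt I x₀) x = (e : TangentSpace I x →L[ℝ] F) :=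
    (coord_eq_mfderiv hx).symm
  rw [h]
  exact congrArg (fun L => L v) (ContinuousLinearMap.inverse_equiv e)

/-- The Lie bracket of vector fields, computed in the chart at `x₀`. -/
theorem coord_mlieBracket [CompleteSpace F] (hx : x ∈ (chartAt H x₀).source)
    {X Y : ∀ x : N, TangentSpace I x}
    (hX : MDifferentiableAt I (I.prod 𝓘(ℝ, F)) (fun y ↦ TotalSpace.mk' F y (X y)) x)
    (hY : MDifferentiableAt I (I.prod 𝓘(ℝ, F)) (fun y ↦ TotalSpace.mk' F y (Y y)) x) :
    coord I x₀ x (VectorField.mlieBracket I X Y x) =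
      fderiv ℝ (repField x₀ Y) (extChartAt I x₀ x) (coord I x₀ x (X x)) -
        fderiv ℝ (repField x₀ X) (extChartAt I x₀ x) (coord I x₀ x (Y x)) := by
  let rep (Y : ∀ x : N, TangentSpace I x) : ∀ z : F, TangentSpace 𝓘(ℝ, F) z := repField x₀ Y
  -- Pulling the coordinate expression back along the chart recovers the field near `x`, so
  -- naturality of the bracket reduces the claim to the bracket on the vector space `F`.
  have hpull : ∀ Y : ∀ x : N, TangentSpace I x,
      VectorField.mpullback I 𝓘(ℝ, F) (extChartAt I x₀) (rep Y) =ᶠ[𝓝 x] Y := by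
    intro Y
    filter_upwards [(chartAt H x₀).open_source.mem_nhds hx] with y hy
    refine (mfderiv_chart_inverse hy _).trans ?_
    exact (congrArg _ (repField_chart hy Y)).trans (coordSymm_coord hy _)
  -- The tangent bundle of `F` is trivialised by the identity, so a differentiable section of it is
  -- just a differentiable function.
  have hm : ∀ {Y : ∀ x : N, TangentSpace I x},
      MDifferentiableAt I (I.prod 𝓘(ℝ, F)) (fun y ↦ TotalSpace.mk' F y (Y y)) x →
      MDifferentiableAt 𝓘(ℝ, F) 𝓘(ℝ, F).tangent
        (fun z ↦ (TotalSpace.mk' F z (rep Y z) : TangentBundle 𝓘(ℝ, F) F))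
        (extChartAt I x₀ x) := by
    intro Y hY
    refine (mdifferentiableAt_coord_iff (x₀ := extChartAt I x₀ x) (mem_chart_source F _)).2 ?_
    refine (differentiableAt_repField hx hY).mdifferentiableAt.congr_of_eventuallyEq
      (Filter.Eventually.of_forall fun z ↦ ?_)
    exact congrArg (fun L : F →L[ℝ] F ↦ L (repField x₀ Y z))
      (TangentBundle.continuousLinearMapAt_model_space (extChartAt I x₀ x) z)
  have : IsManifold I (minSmoothness ℝ 3) N := .of_le (n := ∞) (by
    rw [minSmoothness_of_isRCLikeNormedField]; exact ENat.LEInfty.out)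
  have h := VectorField.mpullback_mlieBracket (n := ∞) (hm hX) (hm hY)
    (contMDiffAt_chart (I := I) hx)
    (by rw [minSmoothness_of_isRCLikeNormedField]; exact ENat.LEInfty.out)
  rw [Filter.EventuallyEq.mlieBracket_vectorField_eq (hpull X) (hpull Y),
    ← VectorField.mlieBracketWithin_univ (V := rep X),
    VectorField.mlieBracketWithin_eq_lieBracketWithin, VectorField.lieBracketWithin_univ] at h
  rw [← h]
  refine (congrArg (coord I x₀ x) (mfderiv_chart_inverse hx _)).trans ?_
  rw [coord_coordSymm hx, ← repField_chart hx X, ← repField_chart hx Y]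
  rfl

end Coordinates

/-! ### Endomorphism fields and bilinear forms in a chart. -/

section Tensors

variable {F : Type*} [NormedAddCommGroup F] [NormedSpace ℝ F] [FiniteDimensional ℝ F]
  {H : Type*} [TopologicalSpace H] {I : ModelWithCorners ℝ F H} [I.Boundaryless]
  {N : Type*} [TopologicalSpace N] [ChartedSpace H N] [IsManifold I ∞ N]
  {x₀ x : N} {z : F}

/-- The coordinate expression of a field of endomorphisms in the chart at `x₀`. -/
def repEnd (x₀ : N) (J : EndField I N) (z : F) : F →L[ℝ] F :=
  coord I x₀ ((extChartAt I x₀).symm z) ∘L J ((extChartAt I x₀).symm z) ∘L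
    coordSymm I x₀ ((extChartAt I x₀).symm z)

/-- The coordinate expression of a field of bilinear forms in the chart at `x₀`. -/
def repForm (x₀ : N) (g : FormField I N) (z : F) : F →L[ℝ] F →L[ℝ] ℝ :=
  let gz : F →L[ℝ] F →L[ℝ] ℝ := g ((extChartAt I x₀).symm z)
  let S : F →L[ℝ] F := coordSymm I x₀ ((extChartAt I x₀).symm z)
  gz.bilinearComp S S

theorem repEnd_apply (J : EndField I N) (v : F) :
    repEnd x₀ J z v = coord I x₀ ((extChartAt I x₀).symm z) (J ((extChartAt I x₀).symm z)
      (coordSymm I x₀ ((extChartAt I x₀).symm z) v)) := rfl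

theorem repForm_apply (g : FormField I N) (v w : F) :
    repForm x₀ g z v w = g ((extChartAt I x₀).symm z)
      (coordSymm I x₀ ((extChartAt I x₀).symm z) v)
      (coordSymm I x₀ ((extChartAt I x₀).symm z) w) := rfl

theorem repEnd_chart (hx : x ∈ (chartAt H x₀).source) (J : EndField I N) (v : F) :
    repEnd x₀ J (extChartAt I x₀ x) v = coord I x₀ x (J x (coordSymm I x₀ x v)) := by
  rw [repEnd_apply, extChartAt_symm_extChartAt hx]

theorem repForm_chart (hx : x ∈ (chartAt H x₀).source) (g : FormField I N) (v w : F) :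
    repForm x₀ g (extChartAt I x₀ x) v w = g x (coordSymm I x₀ x v) (coordSymm I x₀ x w) := by
  rw [repForm_apply, extChartAt_symm_extChartAt hx]

theorem repEnd_chart_coord (hx : x ∈ (chartAt H x₀).source) (J : EndField I N)
    (v : TangentSpace I x) :
    repEnd x₀ J (extChartAt I x₀ x) (coord I x₀ x v) = coord I x₀ x (J x v) := by
  rw [repEnd_chart hx, coordSymm_coord hx]

theorem repForm_chart_coord (hx : x ∈ (chartAt H x₀).source) (g : FormField I N)
    (v w : TangentSpace I x) :
    repForm x₀ g (extChartAt I x₀ x) (coord I x₀ x v) (coord I x₀ x w) = g x v w := by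
  rw [repForm_chart hx, coordSymm_coord hx, coordSymm_coord hx]

theorem repField_comp (hz : z ∈ (extChartAt I x₀).target) (J : EndField I N)
    (Y : ∀ x : N, TangentSpace I x) :
    repField x₀ (fun y ↦ J y (Y y)) z = repEnd x₀ J z (repField x₀ Y z) := by
  rw [repEnd_apply, repField, repField, coordSymm_coord (extChartAt_symm_source hz)]

theorem repForm_repField (hz : z ∈ (extChartAt I x₀).target) (g : FormField I N)
    (Y Z : ∀ x : N, TangentSpace I x) :
    g ((extChartAt I x₀).symm z) (Y ((extChartAt I x₀).symm z)) (Z ((extChartAt I x₀).symm z)) =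
      repForm x₀ g z (repField x₀ Y z) (repField x₀ Z z) := by
  rw [repForm_apply, repField, repField, coordSymm_coord (extChartAt_symm_source hz),
    coordSymm_coord (extChartAt_symm_source hz)]

/-- Smoothness of a field of endomorphisms. -/
abbrev SmoothEnd (J : EndField I N) : Prop :=
  ContMDiff I (I.prod 𝓘(ℝ, F →L[ℝ] F)) ∞ (fun x ↦ TotalSpace.mk' (F →L[ℝ] F)
    (E := fun x : N ↦ TangentSpace I x →L[ℝ] TangentSpace I x) x (J x))

/-- Smoothness of a field of bilinear forms. -/
abbrev SmoothForm (g : FormField I N) : Prop :=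
  ContMDiff I (I.prod 𝓘(ℝ, F →L[ℝ] F →L[ℝ] ℝ)) ∞ (fun x ↦ TotalSpace.mk' (F →L[ℝ] F →L[ℝ] ℝ)
    (E := fun x : N ↦ TangentSpace I x →L[ℝ] TangentSpace I x →L[ℝ] ℝ) x (g x))

/-- In finite dimension an operator-valued map is smooth once its values on fixed vectors are, and
these are the coordinates of `J` applied to constant coordinate fields. -/
theorem contDiffOn_repEnd {J : EndField I N} (hJ : SmoothEnd J) (x₀ : N) :
    ContDiffOn ℝ ∞ (repEnd x₀ J) (extChartAt I x₀).target := by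
  rw [contDiffOn_clm_apply]
  intro v z hz
  have hx := extChartAt_symm_source hz
  have h := contDiffAt_repField hx ((hJ ((extChartAt I x₀).symm z)).clm_bundle_apply
    (contMDiffAt_ofRepField (n := ⊤) hx (contDiffAt_const (c := v))))
  rw [(extChartAt I x₀).right_inv hz] at h
  refine (h.congr_of_eventuallyEq ?_).contDiffWithinAt
  filter_upwards [(isOpen_extChartAt_target x₀).mem_nhds hz] with y hy
  rw [repField_comp hy, repField_ofRepField hy]

theorem contDiffOn_repForm {g : FormField I N} (hg : SmoothForm g) (x₀ : N) :
    ContDiffOn ℝ ∞ (repForm x₀ g) (extChartAt I x₀).target := by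
  rw [contDiffOn_clm_apply]
  intro v
  rw [contDiffOn_clm_apply]
  intro w z hz
  have hx := extChartAt_symm_source hz
  have h := ContMDiffAt.clm_bundle_apply₂ (E₃ := fun _ : N ↦ ℝ) (hg ((extChartAt I x₀).symm z))
    (contMDiffAt_ofRepField (n := ⊤) hx (contDiffAt_const (c := v)))
    (contMDiffAt_ofRepField (n := ⊤) hx (contDiffAt_const (c := w)))
  have h₁ : ContMDiffAt I 𝓘(ℝ, ℝ) ∞
      (fun y ↦ g y (ofRepField I x₀ (fun _ ↦ v) y) (ofRepField I x₀ (fun _ ↦ w) y))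
      ((extChartAt I x₀).symm z) := (contMDiffAt_totalSpace.1 h).2
  have h₂ := contDiffAt_comp_chart_symm (n := ⊤) hx h₁
  rw [(extChartAt I x₀).right_inv hz] at h₂
  refine (h₂.congr_of_eventuallyEq ?_).contDiffWithinAt
  filter_upwards [(isOpen_extChartAt_target x₀).mem_nhds hz] with y hy
  rw [repForm_repField hy, repField_ofRepField hy, repField_ofRepField hy]

/-- Smoothness at a point of the hom bundle is read in the trivialisation centred there, so only the
centre of each chart has to be tested. -/
theorem smoothEnd_of_repEnd {J : EndField I N}
    (h : ∀ x₀ : N, ContDiffAt ℝ ∞ (repEnd x₀ J) (extChartAt I x₀ x₀)) : SmoothEnd J := by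
  intro x₀
  rw [contMDiffAt_hom_bundle]
  refine ⟨contMDiffAt_id, ?_⟩
  have h' := contMDiffAt_comp_chart (n := ⊤) (mem_chart_source H x₀) (h x₀)
  refine h'.congr_of_eventuallyEq ?_
  filter_upwards [(chartAt H x₀).open_source.mem_nhds (mem_chart_source H x₀)] with y hy
  ext v
  rw [repEnd_chart hy]
  rfl

theorem smoothForm_of_repForm {g : FormField I N}
    (h : ∀ x₀ : N, ContDiffAt ℝ ∞ (repForm x₀ g) (extChartAt I x₀ x₀)) : SmoothForm g := by
  intro x₀
  rw [contMDiffAt_hom_bundle]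
  refine ⟨contMDiffAt_id, ?_⟩
  have h' := contMDiffAt_comp_chart (n := ⊤) (mem_chart_source H x₀) (h x₀)
  refine h'.congr_of_eventuallyEq ?_
  filter_upwards [(chartAt H x₀).open_source.mem_nhds (mem_chart_source H x₀)] with y hy
  ext v w
  rw [repForm_chart hy]
  -- The values lie in the trivial line bundle, whose trivialisation is the identity and drops out.
  refine (inCoordinates_apply_eq₂ (E₃ := fun _ : N ↦ ℝ) hy hy (by simp)).trans ?_
  have hS (v : F) : coordSymm I x₀ y v = (trivializationAt F (TangentSpace I) x₀).symm y v :=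
    Trivialization.symmL_apply (R := ℝ) _ hy v
  rw [hS, hS]
  exact congrArg (fun L : ℝ →ₗ[ℝ] ℝ ↦ L _) (Bundle.Trivial.linearMapAt_trivialization ℝ N ℝ y)

end Tensors

/-! ### Christoffel symbols and curvature on a vector space. -/

section Christoffel

variable {F : Type*} [NormedAddCommGroup F] [NormedSpace ℝ F]

/-- `Γ` satisfies at `z` the equations of the Christoffel symbols of the metric `g`. -/
structure IsChristoffel (g : F → F →L[ℝ] F →L[ℝ] ℝ) (Γ : F → F →L[ℝ] F →L[ℝ] F) (z : F) :
    Prop where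
  symm : ∀ a b, Γ z a b = Γ z b a
  compat : ∀ a b c, fderiv ℝ g z a b c = g z (Γ z a b) c + g z b (Γ z a c)

/-- The right-hand side of the Koszul formula for coordinate fields. -/
def koszulForm (D : F →L[ℝ] F →L[ℝ] F →L[ℝ] ℝ) : F →L[ℝ] F →L[ℝ] F →L[ℝ] ℝ :=
  (1 / 2 : ℝ) • (D + D.flip -
    (ContinuousLinearMap.flipₗᵢ ℝ F F ℝ : (F →L[ℝ] F →L[ℝ] ℝ) →L[ℝ] F →L[ℝ] F →L[ℝ] ℝ).comp D.flip)

theorem koszulForm_apply (D : F →L[ℝ] F →L[ℝ] F →L[ℝ] ℝ) (a b c : F) :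
    koszulForm D a b c = 1 / 2 * (D a b c + D b a c - D c a b) := rfl

/-- The Christoffel symbols of the metric `g`. -/
def christoffel (g : F → F →L[ℝ] F →L[ℝ] ℝ) (z : F) : F →L[ℝ] F →L[ℝ] F :=
  (ContinuousLinearMap.compL ℝ F (F →L[ℝ] ℝ) F (g z).inverse).comp (koszulForm (fderiv ℝ g z))

theorem christoffel_apply (g : F → F →L[ℝ] F →L[ℝ] ℝ) (z a b : F) :
    christoffel g z a b = (g z).inverse (koszulForm (fderiv ℝ g z) a b) := rfl

theorem fderiv_clm_apply_const {X Y Z : Type*} [NormedAddCommGroup X] [NormedSpace ℝ X]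
    [NormedAddCommGroup Y] [NormedSpace ℝ Y] [NormedAddCommGroup Z] [NormedSpace ℝ Z]
    {A : X → Y →L[ℝ] Z} {x : X} (hA : DifferentiableAt ℝ A x) (v : X) (y : Y) :
    fderiv ℝ (fun x ↦ A x y) x v = fderiv ℝ A x v y := by
  rw [(hA.hasFDerivAt.clm_apply (hasFDerivAt_const y x)).fderiv]
  simp

theorem fderiv_bilin_symm {G : Type*} [NormedAddCommGroup G] [NormedSpace ℝ G]
    {B : F → F →L[ℝ] F →L[ℝ] G} {z : F} (hd : DifferentiableAt ℝ B z)
    (hs : ∀ᶠ y in 𝓝 z, ∀ a b, B y a b = B y b a) (a b c : F) :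
    fderiv ℝ B z a b c = fderiv ℝ B z a c b := by
  have h : ∀ b, DifferentiableAt ℝ (fun y ↦ B y b) z := fun b ↦
    hd.clm_apply (differentiableAt_const b)
  rw [← fderiv_clm_apply_const hd, ← fderiv_clm_apply_const (h b), ← fderiv_clm_apply_const hd,
    ← fderiv_clm_apply_const (h c)]
  rw [Filter.EventuallyEq.fderiv_eq (hs.mono fun y hy ↦ hy b c)]

/-- Koszul's argument: the cyclic combination of three compatibility equations, with symmetry,
determines $2g(\Gamma(a,b),c)$, and $g$ is nondegenerate. -/
theorem IsChristoffel.unique {g : F → F →L[ℝ] F →L[ℝ] ℝ} {Γ Γ' : F → F →L[ℝ] F →L[ℝ] F} {z : F}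
    (hs : ∀ a b, g z a b = g z b a) (hn : ∀ a, (∀ b, g z a b = 0) → a = 0)
    (h : IsChristoffel g Γ z) (h' : IsChristoffel g Γ' z) : Γ z = Γ' z := by
  have key : ∀ {Γ : F → F →L[ℝ] F →L[ℝ] F}, IsChristoffel g Γ z → ∀ a b c,
      2 * g z (Γ z a b) c =
        fderiv ℝ g z a b c + fderiv ℝ g z b a c - fderiv ℝ g z c a b := by
    intro Γ h a b c
    rw [h.compat, h.compat, h.compat, h.symm b a, h.symm c a, h.symm c b, hs (Γ z a c) b]
    ring
  ext a b
  rw [← sub_eq_zero]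
  refine hn _ fun c ↦ ?_
  have := key h a b c
  have := key h' a b c
  rw [map_sub, sub_apply]
  linarith

section FiniteDimensional

variable [FiniteDimensional ℝ F]

/-- An injective linear map from `F` to its dual is bijective because the dimensions agree. -/
theorem isInvertible_of_nondegenerate {B : F →L[ℝ] F →L[ℝ] ℝ} (hn : ∀ a, (∀ b, B a b = 0) → a = 0) :
    B.IsInvertible := by
  have hinj : Function.Injective (B : F →ₗ[ℝ] F →L[ℝ] ℝ) := by
    refine (injective_iff_map_eq_zero _).2 fun a ha ↦ hn a fun b ↦ ?_
    exact congrArg (fun L : F →L[ℝ] ℝ ↦ L b) ha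
  have hdim : Module.finrank ℝ F = Module.finrank ℝ (F →L[ℝ] ℝ) := by
    rw [← LinearEquiv.finrank_eq (LinearMap.toContinuousLinearMap (𝕜 := ℝ) (E := F) (F' := ℝ))]
    exact (Subspace.dual_finrank_eq (K := ℝ) (V := F)).symm
  exact ⟨(LinearEquiv.ofInjectiveOfFinrankEq (B : F →ₗ[ℝ] F →L[ℝ] ℝ) hinj hdim).toContinuousLinearEquiv,
    ContinuousLinearMap.ext fun _ ↦ rfl⟩

/-- By construction $g(\Gamma(a,b),c)$ is the Koszul expression. Symmetry and compatibility are then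
linear identities among derivatives of $g$, using that $\partial g$ inherits the symmetry of $g$. -/
theorem isChristoffel_christoffel {g : F → F →L[ℝ] F →L[ℝ] ℝ} {z : F}
    (hd : DifferentiableAt ℝ g z) (hs : ∀ᶠ y in 𝓝 z, ∀ a b, g y a b = g y b a)
    (hn : ∀ a, (∀ b, g z a b = 0) → a = 0) : IsChristoffel g (christoffel g) z := by
  have hsymm := fderiv_bilin_symm hd hs
  have hs := hs.self_of_nhds
  have hinv := isInvertible_of_nondegenerate hn
  have key : ∀ a b c, g z (christoffel g z a b) c =
      1 / 2 * (fderiv ℝ g z a b c + fderiv ℝ g z b a c - fderiv ℝ g z c a b) := by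
    intro a b c
    rw [← koszulForm_apply, christoffel_apply, hinv.self_apply_inverse]
  constructor
  · intro a b
    rw [christoffel_apply, christoffel_apply]
    congr 1
    ext c
    rw [koszulForm_apply, koszulForm_apply, hsymm c a b]
    ring
  · intro a b c
    rw [hs b, key, key, hsymm a c b]
    ring

/-- Inversion of operators is smooth at every isomorphism, and the Koszul expression is linear in
$\partial g$. -/
theorem contDiffOn_christoffel {g : F → F →L[ℝ] F →L[ℝ] ℝ} {U : Set F} (hU : IsOpen U)
    (hg : ContDiffOn ℝ ∞ g U) (hn : ∀ z ∈ U, ∀ a, (∀ b, g z a b = 0) → a = 0) :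
    ContDiffOn ℝ ∞ (christoffel g) U := by
  have hD : ContDiffOn ℝ ∞ (fderiv ℝ g) U := hg.fderiv_of_isOpen hU (by simp)
  have hinv : ContDiffOn ℝ ∞ (fun z ↦ (g z).inverse) U := by
    intro z hz
    obtain ⟨e, he⟩ := isInvertible_of_nondegenerate (hn z hz)
    have h := contDiffAt_map_inverse (𝕜 := ℝ) (n := ∞) e
    rw [he] at h
    exact h.comp_contDiffWithinAt z (hg z hz)
  have hK : ContDiffOn ℝ ∞ (fun z ↦ koszulForm (fderiv ℝ g z)) U := by
    rw [contDiffOn_clm_apply]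
    intro a
    rw [contDiffOn_clm_apply]
    intro b
    rw [contDiffOn_clm_apply]
    intro c
    simp only [koszulForm_apply]
    have h : ∀ a b c : F, ContDiffOn ℝ ∞ (fun z ↦ fderiv ℝ g z a b c) U := fun a b c ↦
      ((hD.clm_apply contDiffOn_const).clm_apply contDiffOn_const).clm_apply contDiffOn_const
    exact contDiffOn_const.mul (((h a b c).add (h b a c)).sub (h c a b))
  rw [contDiffOn_clm_apply]
  intro a
  rw [contDiffOn_clm_apply]
  intro b
  simp only [christoffel_apply]
  exact hinv.clm_apply ((hK.clm_apply contDiffOn_const).clm_apply contDiffOn_const)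

end FiniteDimensional

/-- The curvature of the connection with Christoffel symbols `Γ`. -/
def coordCurvature (Γ : F → F →L[ℝ] F →L[ℝ] F) (z a b c : F) : F :=
  fderiv ℝ Γ z a b c - fderiv ℝ Γ z b a c + Γ z a (Γ z b c) - Γ z b (Γ z a c)

/-- The covariant derivative of a field of endomorphisms for the connection with Christoffel
symbols `Γ`. -/
def coordDerivEnd (Γ : F → F →L[ℝ] F →L[ℝ] F) (J : F → F →L[ℝ] F) (z a b : F) : F :=
  fderiv ℝ J z a b + Γ z a (J z b) - J z (Γ z a b)

/-- The Ricci identity for a parallel $J$: antisymmetrising the second derivative of $J$ gives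
$R(a,b)J-JR(a,b)$, and second partial derivatives commute. Vanishing of $\nabla J$ near `z`, not
only at `z`, is needed in order to differentiate it. -/
theorem coordCurvature_comm {Γ : F → F →L[ℝ] F →L[ℝ] F} {J : F → F →L[ℝ] F} {z : F}
    (hΓ : DifferentiableAt ℝ Γ z) (hJ : ContDiffAt ℝ ∞ J z)
    (h : ∀ᶠ y in 𝓝 z, ∀ a b, coordDerivEnd Γ J y a b = 0) (a b c : F) :
    coordCurvature Γ z a b (J z c) = J z (coordCurvature Γ z a b c) := by
  have hJd : DifferentiableAt ℝ J z := hJ.differentiableAt (by simp)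
  have hJ' : DifferentiableAt ℝ (fderiv ℝ J) z :=
    (hJ.fderiv_right (m := ∞) (by simp)).differentiableAt (by simp)
  have hJz : ∀ a b, fderiv ℝ J z a b = J z (Γ z a b) - Γ z a (J z b) := by
    intro a b
    have := h.self_of_nhds a b
    rw [coordDerivEnd] at this
    rw [← sub_eq_zero, ← this]; abel
  have hsymm := hJ.isSymmSndFDerivAt (by simp; exact ENat.LEInfty.out)
  -- The derivative in direction `a` of $\partial_bJ\,c=J\Gamma(b,c)-\Gamma(b,Jc)$, which holds
  -- throughout a neighbourhood.
  have key : ∀ a b, fderiv ℝ (fderiv ℝ J) z a b c =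
      fderiv ℝ J z a (Γ z b c) + J z (fderiv ℝ Γ z a b c) - fderiv ℝ Γ z a b (J z c)
        - Γ z b (fderiv ℝ J z a c) := by
    intro a b
    have h1 : HasFDerivAt (fun y ↦ fderiv ℝ J y b c)
        (((fderiv ℝ (fderiv ℝ J) z).flip b).flip c) z := by
      simpa using (hJ'.hasFDerivAt.clm_apply (hasFDerivAt_const b z)).clm_apply
        (hasFDerivAt_const c z)
    have hΓb := hΓ.hasFDerivAt.clm_apply (hasFDerivAt_const b z)
    have h2 := (hJd.hasFDerivAt.clm_apply (hΓb.clm_apply (hasFDerivAt_const c z))).sub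
      (hΓb.clm_apply (hJd.hasFDerivAt.clm_apply (hasFDerivAt_const c z)))
    have h3 := h1.unique (h2.congr_of_eventuallyEq (h.mono fun y hy ↦ by
      have := hy b c
      rw [coordDerivEnd] at this
      simp only [Pi.sub_apply]
      rw [← sub_eq_zero, ← this]; abel))
    have h4 := congrArg (fun L : F →L[ℝ] F ↦ L a) h3
    simp at h4
    rw [h4]; abel
  have e := hsymm a b
  have e' : fderiv ℝ (fderiv ℝ J) z a b c = fderiv ℝ (fderiv ℝ J) z b a c := by rw [e]
  rw [key, key] at e'
  simp only [hJz, map_sub] at e'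
  simp only [coordCurvature, map_add, map_sub]
  rw [← sub_eq_zero] at e' ⊢
  rw [← neg_eq_zero, ← e']
  abel

end Christoffel

/-! ### Existence of the Levi-Civita connection and its form in a chart. -/

section LeviCivita

variable {F : Type*} [NormedAddCommGroup F] [NormedSpace ℝ F] [FiniteDimensional ℝ F]
  {H : Type*} [TopologicalSpace H] {I : ModelWithCorners ℝ F H} [I.Boundaryless]
  {N : Type*} [TopologicalSpace N] [ChartedSpace H N] [IsManifold I ∞ N]
  {x₀ x : N} {z : F}

/-- The connection with Christoffel symbols `Γ` in the chart at `x₀`. -/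
def chartConnection (x₀ : N) (Γ : F → F →L[ℝ] F →L[ℝ] F) : Connection I N := fun Y x ↦
  coordSymm I x₀ x ∘L (fderiv ℝ (repField x₀ Y) (extChartAt I x₀ x) +
    (Γ (extChartAt I x₀ x)).flip (coord I x₀ x (Y x))) ∘L coord I x₀ x

theorem coord_chartConnection (hx : x ∈ (chartAt H x₀).source) (Γ : F → F →L[ℝ] F →L[ℝ] F)
    (Y : ∀ x : N, TangentSpace I x) (v : TangentSpace I x) :
    coord I x₀ x (chartConnection x₀ Γ Y x v) =
      fderiv ℝ (repField x₀ Y) (extChartAt I x₀ x) (coord I x₀ x v) +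
        Γ (extChartAt I x₀ x) (coord I x₀ x v) (coord I x₀ x (Y x)) :=
  coord_coordSymm hx _

theorem isCovariantDerivativeOn_chartConnection (x₀ : N) (Γ : F → F →L[ℝ] F →L[ℝ] F) :
    IsCovariantDerivativeOn F (chartConnection (I := I) x₀ Γ) (chartAt H x₀).source where
  add {Y Z x} hY hZ hx := by
    ext v
    refine coord_injective hx ?_
    have h : fderiv ℝ (repField x₀ (Y + Z)) (extChartAt I x₀ x) =
        fderiv ℝ (repField x₀ Y) (extChartAt I x₀ x) +
          fderiv ℝ (repField x₀ Z) (extChartAt I x₀ x) := by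
      rw [← fderiv_add (differentiableAt_repField hx hY) (differentiableAt_repField hx hZ)]
      congr 1
      funext z
      exact map_add _ _ _
    refine (coord_chartConnection hx Γ (Y + Z) v).trans ?_
    rw [h, add_apply, Pi.add_apply, map_add, map_add, add_apply, map_add,
      coord_chartConnection hx, coord_chartConnection hx]
    abel
  leibniz {Y f x} hY hf hx := by
    ext v
    refine coord_injective hx ?_
    have h : fderiv ℝ (repField x₀ (f • Y)) (extChartAt I x₀ x) (coord I x₀ x v) =
        f x • fderiv ℝ (repField x₀ Y) (extChartAt I x₀ x) (coord I x₀ x v) +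
          mvfderiv I f x v • coord I x₀ x (Y x) := by
      have h' := fderiv_fun_smul (differentiableAt_comp_chart_symm hx hf)
        (differentiableAt_repField hx hY)
      have h'' : repField x₀ (f • Y) =
          fun z ↦ f ((extChartAt I x₀).symm z) • repField x₀ Y z := by
        funext z
        exact map_smul _ _ _
      rw [h'', h', mvfderiv_eq_fderiv hx hf, extChartAt_symm_extChartAt hx, repField_chart hx]
      rfl
    refine (coord_chartConnection hx Γ (f • Y) v).trans ?_
    rw [h, add_apply, smul_apply, ContinuousLinearMap.smulRight_apply, map_add, map_smul, map_smul,
      coord_chartConnection hx, Pi.smul_apply', map_smul, map_smul]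
    module

/-- In the chart at `x₀` the connection `D` has Christoffel symbols `Γ`. -/
def HasChristoffel (D : Connection I N) (x₀ : N) (Γ : F → F →L[ℝ] F →L[ℝ] F) : Prop :=
  ∀ x ∈ (chartAt H x₀).source, ∀ Y : ∀ x : N, TangentSpace I x,
    MDifferentiableAt I (I.prod 𝓘(ℝ, F)) (fun y ↦ TotalSpace.mk' F y (Y y)) x →
    ∀ v : TangentSpace I x, coord I x₀ x (D Y x v) =
      fderiv ℝ (repField x₀ Y) (extChartAt I x₀ x) (coord I x₀ x v) +
        Γ (extChartAt I x₀ x) (coord I x₀ x v) (coord I x₀ x (Y x))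

/-- The difference between two covariant derivatives is a tensor. Comparing with the flat derivative
of the chart, that tensor supplies the Christoffel symbols. -/
theorem exists_hasChristoffel (cov : CovariantDerivative I F (TangentSpace I : N → Type _))
    (x₀ : N) : ∃ Γ, HasChristoffel cov.toFun x₀ Γ := by
  have hcov : IsCovariantDerivativeOn F cov.toFun (chartAt H x₀).source :=
    cov.isCovariantDerivativeOn
  have hchart := isCovariantDerivativeOn_chartConnection (I := I) x₀ 0
  let A : ∀ x : N, TangentSpace I x →L[ℝ] TangentSpace I x →L[ℝ] TangentSpace I x :=
    hcov.difference hchart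
  -- `difference` takes the value of the section first and the direction second, whence the `flip`.
  let Γ (z : F) : F →L[ℝ] F →L[ℝ] F :=
    let Az : F →L[ℝ] F →L[ℝ] F := A ((extChartAt I x₀).symm z)
    let S : F →L[ℝ] F := coordSymm I x₀ ((extChartAt I x₀).symm z)
    let T : F →L[ℝ] F := coord I x₀ ((extChartAt I x₀).symm z)
    (ContinuousLinearMap.compL ℝ F F F T).comp (Az.bilinearComp S S).flip
  have hΓ : ∀ z a b, Γ z a b = coord I x₀ ((extChartAt I x₀).symm z)
      (A ((extChartAt I x₀).symm z) (coordSymm I x₀ ((extChartAt I x₀).symm z) b)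
        (coordSymm I x₀ ((extChartAt I x₀).symm z) a)) := fun _ _ _ ↦ rfl
  refine ⟨Γ, fun x hx Y hY v ↦ ?_⟩
  have h := IsCovariantDerivativeOn.difference_apply hcov hchart hx hY
  have h' : A x (Y x) v = cov.toFun Y x v - chartConnection x₀ 0 Y x v :=
    congrArg (fun L : TangentSpace I x →L[ℝ] TangentSpace I x ↦ L v) h
  rw [hΓ, extChartAt_symm_extChartAt hx, coordSymm_coord hx, coordSymm_coord hx, h', map_sub,
    coord_chartConnection hx, Pi.zero_apply]
  simp

theorem fderiv_repField_ofRepField_const (hx : x ∈ (chartAt H x₀).source) (a : F) :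
    fderiv ℝ (repField x₀ (ofRepField I x₀ fun _ ↦ a)) (extChartAt I x₀ x) = 0 := by
  have h : repField x₀ (ofRepField I x₀ fun _ ↦ a) =ᶠ[𝓝 (extChartAt I x₀ x)] fun _ ↦ a := by
    filter_upwards [(isOpen_extChartAt_target x₀).mem_nhds (extChartAt_mem_target hx)] with z hz
    exact repField_ofRepField hz _
  rw [h.fderiv_eq, fderiv_fun_const]
  rfl

theorem coord_ofRepField (hx : x ∈ (chartAt H x₀).source) (W : F → F) :
    coord I x₀ x (ofRepField I x₀ W x) = W (extChartAt I x₀ x) :=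
  coord_coordSymm hx _

/-- The function `g(Y, Z)` and its derivative in coordinates. -/
theorem mvfderiv_form {g : FormField I N} (hg : SmoothForm g) (hx : x ∈ (chartAt H x₀).source)
    {Y Z : ∀ x : N, TangentSpace I x}
    (hY : MDifferentiableAt I (I.prod 𝓘(ℝ, F)) (fun y ↦ TotalSpace.mk' F y (Y y)) x)
    (hZ : MDifferentiableAt I (I.prod 𝓘(ℝ, F)) (fun y ↦ TotalSpace.mk' F y (Z y)) x)
    (v : TangentSpace I x) :
    mvfderiv I (fun y ↦ g y (Y y) (Z y)) x v =
      fderiv ℝ (repForm x₀ g) (extChartAt I x₀ x) (coord I x₀ x v) (coord I x₀ x (Y x))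
          (coord I x₀ x (Z x)) +
        repForm x₀ g (extChartAt I x₀ x)
          (fderiv ℝ (repField x₀ Y) (extChartAt I x₀ x) (coord I x₀ x v)) (coord I x₀ x (Z x)) +
        repForm x₀ g (extChartAt I x₀ x) (coord I x₀ x (Y x))
          (fderiv ℝ (repField x₀ Z) (extChartAt I x₀ x) (coord I x₀ x v)) := by
  have hz := extChartAt_mem_target (I := I) hx
  have hmem := (isOpen_extChartAt_target (I := I) x₀).mem_nhds hz
  have hf : MDifferentiableAt I 𝓘(ℝ, ℝ) (fun y ↦ g y (Y y) (Z y)) x := by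
    have h := MDifferentiableAt.clm_bundle_apply₂ (E₃ := fun _ : N ↦ ℝ)
      ((hg x).mdifferentiableAt (by simp)) hY hZ
    exact (mdifferentiableAt_totalSpace (IB := I) _ |>.1 h).2
  rw [mvfderiv_eq_fderiv hx hf]
  have he : (fun z ↦ g ((extChartAt I x₀).symm z) (Y ((extChartAt I x₀).symm z))
      (Z ((extChartAt I x₀).symm z))) =ᶠ[𝓝 (extChartAt I x₀ x)]
      fun z ↦ repForm x₀ g z (repField x₀ Y z) (repField x₀ Z z) := by
    filter_upwards [hmem] with y hy
    exact repForm_repField hy g Y Z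
  have hgd : DifferentiableAt ℝ (repForm x₀ g) (extChartAt I x₀ x) :=
    ((contDiffOn_repForm hg x₀).contDiffAt hmem).differentiableAt (by simp)
  have hd := (hgd.hasFDerivAt.clm_apply (differentiableAt_repField hx hY).hasFDerivAt).clm_apply
    (differentiableAt_repField hx hZ).hasFDerivAt
  rw [he.fderiv_eq, hd.fderiv, ← repField_chart hx Y, ← repField_chart hx Z]
  simp
  abel

/-- Evaluate on coordinate fields: they commute, so vanishing torsion is symmetry of `Γ`, and
metricity becomes the compatibility equation. -/
theorem IsLeviCivita.isChristoffel {g : FormField I N} (hg : SmoothForm g)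
    {cov : CovariantDerivative I F (TangentSpace I : N → Type _)} (hcov : IsLeviCivita g cov)
    {Γ : F → F →L[ℝ] F →L[ℝ] F} (hΓ : HasChristoffel cov.toFun x₀ Γ)
    (hz : z ∈ (extChartAt I x₀).target) : IsChristoffel (repForm x₀ g) Γ z := by
  have : CompleteSpace F := FiniteDimensional.complete ℝ F
  obtain ⟨x, hx, rfl⟩ : ∃ x ∈ (chartAt H x₀).source, extChartAt I x₀ x = z :=
    ⟨_, extChartAt_symm_source hz, (extChartAt I x₀).right_inv hz⟩
  have hm : ∀ a : F, MDifferentiableAt I (I.prod 𝓘(ℝ, F))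
      (fun y ↦ TotalSpace.mk' F y (ofRepField I x₀ (fun _ ↦ a) y)) x := fun a ↦
    mdifferentiableAt_ofRepField hx (differentiableAt_const a)
  have hD : ∀ a b : F, coord I x₀ x (cov.toFun (ofRepField I x₀ fun _ ↦ b) x
      (ofRepField I x₀ (fun _ ↦ a) x)) = Γ (extChartAt I x₀ x) a b := by
    intro a b
    rw [hΓ x hx _ (hm b), fderiv_repField_ofRepField_const hx, coord_ofRepField hx,
      coord_ofRepField hx, zero_apply, zero_add]
  constructor
  · intro a b
    have h := (CovariantDerivative.torsion_eq_zero_iff cov).1 hcov.torsion_free (hm a) (hm b)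
    have h' := coord_mlieBracket hx (hm a) (hm b)
    rw [fderiv_repField_ofRepField_const hx, fderiv_repField_ofRepField_const hx] at h'
    rw [← h, map_sub] at h'
    erw [hD a b, hD b a] at h'
    simpa [sub_eq_zero] using h'
  · intro a b c
    have h := hcov.metric x _ _ (hm b) (hm c) (ofRepField I x₀ (fun _ ↦ a) x)
    rw [mvfderiv_form hg hx (hm b) (hm c)] at h
    rw [← repForm_chart_coord hx, ← repForm_chart_coord hx, fderiv_repField_ofRepField_const hx,
      fderiv_repField_ofRepField_const hx] at h
    erw [hD a b, hD a c] at h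
    simpa [coord_ofRepField hx] using h

theorem repForm_symm {g : FormField I N} (hg : IsPseudoRiemannian g) (z a b : F) :
    repForm x₀ g z a b = repForm x₀ g z b a := by
  rw [repForm_apply, repForm_apply, hg.symm]

theorem repForm_nondegenerate {g : FormField I N} (hg : IsPseudoRiemannian g)
    (hz : z ∈ (extChartAt I x₀).target) (a : F) (h : ∀ b, repForm x₀ g z a b = 0) : a = 0 := by
  have hx := extChartAt_symm_source hz
  have h0 : coordSymm I x₀ ((extChartAt I x₀).symm z) a = 0 := by
    refine hg.nondegenerate _ _ fun w ↦ ?_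
    rw [← coordSymm_coord hx w]
    exact h _
  rw [← coord_coordSymm (I := I) hx a, h0, map_zero]

theorem isChristoffel_repForm {g : FormField I N} (hg : IsPseudoRiemannian g)
    (hz : z ∈ (extChartAt I x₀).target) :
    IsChristoffel (repForm x₀ g) (christoffel (repForm x₀ g)) z :=
  isChristoffel_christoffel
    (((contDiffOn_repForm hg.smooth x₀).contDiffAt
      ((isOpen_extChartAt_target x₀).mem_nhds hz)).differentiableAt (by simp))
    (Filter.Eventually.of_forall fun _ ↦ repForm_symm hg _) (repForm_nondegenerate hg hz)

theorem contDiffOn_christoffel_repForm {g : FormField I N} (hg : IsPseudoRiemannian g) (x₀ : N) :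
    ContDiffOn ℝ ∞ (christoffel (repForm x₀ g)) (extChartAt I x₀).target :=
  contDiffOn_christoffel (isOpen_extChartAt_target x₀) (contDiffOn_repForm hg.smooth x₀)
    fun _ hz ↦ repForm_nondegenerate hg hz

/-- Existence of the Levi-Civita connection. -/
theorem exists_isLeviCivita {g : FormField I N} (hg : IsPseudoRiemannian g) :
    ∃ cov : CovariantDerivative I F (TangentSpace I : N → Type _), IsLeviCivita g cov := by
  have : CompleteSpace F := FiniteDimensional.complete ℝ F
  let Γ (x : N) := christoffel (repForm x g)
  have hs (x : N) := mem_chart_source H x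
  have hC (x : N) := isChristoffel_repForm hg (extChartAt_mem_target (I := I) (hs x))
  -- At each point the connection of the chart centred there is used. No gluing is needed, because
  -- additivity and the Leibniz rule are conditions at a single point.
  let cov : CovariantDerivative I F (TangentSpace I : N → Type _) :=
    { toFun := fun Y x ↦ chartConnection x (Γ x) Y x
      isCovariantDerivativeOnUniv :=
        { add := fun {_ _ x} hY hZ _ ↦
            (isCovariantDerivativeOn_chartConnection x (Γ x)).add hY hZ (hs x)
          leibniz := fun {_ _ x} hY hf _ ↦
            (isCovariantDerivativeOn_chartConnection x (Γ x)).leibniz hY hf (hs x) } }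
  have hD (x : N) (Y : ∀ x : N, TangentSpace I x) (v : TangentSpace I x) :
      coord I x x (cov.toFun Y x v) =
        fderiv ℝ (repField x Y) (extChartAt I x x) (coord I x x v) +
          Γ x (extChartAt I x x) (coord I x x v) (coord I x x (Y x)) :=
    coord_chartConnection (hs x) _ _ _
  refine ⟨cov, ⟨(CovariantDerivative.torsion_eq_zero_iff cov).2 fun {X Y x} hX hY ↦ ?_,
    fun x Y Z hY hZ v ↦ ?_⟩⟩
  · refine coord_injective (hs x) ?_
    rw [map_sub, hD, hD, coord_mlieBracket (hs x) hX hY, (hC x).symm (coord I x x (Y x))]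
    abel
  · rw [mvfderiv_form hg.smooth (hs x) hY hZ, ← repForm_chart_coord (hs x),
      ← repForm_chart_coord (hs x), hD, hD, (hC x).compat, map_add, map_add, add_apply]
    ring

/-- Existence rules out the default value `0` in the definition of `leviCivita`. -/
theorem leviCivita_spec {g : FormField I N} (hg : IsPseudoRiemannian g) :
    ∃ cov : CovariantDerivative I F (TangentSpace I : N → Type _),
      IsLeviCivita g cov ∧ leviCivita g = cov.toFun := by
  have h := exists_isLeviCivita hg
  exact ⟨h.choose, h.choose_spec, dif_pos h⟩

/-- In coordinates, the Levi-Civita connection is given by the Christoffel symbols. -/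
theorem hasChristoffel_of_isChristoffel {g : FormField I N} (hg : IsPseudoRiemannian g) {x₀ : N}
    {Γ : F → F →L[ℝ] F →L[ℝ] F}
    (hΓ : ∀ z ∈ (extChartAt I x₀).target, IsChristoffel (repForm x₀ g) Γ z) :
    HasChristoffel (leviCivita g) x₀ Γ := by
  obtain ⟨cov, hcov, h⟩ := leviCivita_spec hg
  obtain ⟨Γ', hΓ'⟩ := exists_hasChristoffel cov x₀
  rw [h]
  intro x hx Y hY v
  have hz := extChartAt_mem_target (I := I) hx
  rw [hΓ' x hx Y hY v, (hΓ _ hz).unique (repForm_symm hg _) (repForm_nondegenerate hg hz)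
    (hcov.isChristoffel hg.smooth hΓ' hz)]

end LeviCivita

/-! ### Parallelism, flatness and integrability in a chart. -/

section Parallel

variable {F : Type*} [NormedAddCommGroup F] [NormedSpace ℝ F] [FiniteDimensional ℝ F]
  {H : Type*} [TopologicalSpace H] {I : ModelWithCorners ℝ F H} [I.Boundaryless]
  {N : Type*} [TopologicalSpace N] [ChartedSpace H N] [IsManifold I ∞ N]
  {x₀ x : N} {z : F}

theorem mdifferentiableAt_end {J : EndField I N} (hJ : SmoothEnd J)
    {Y : ∀ x : N, TangentSpace I x}
    (hY : MDifferentiableAt I (I.prod 𝓘(ℝ, F)) (fun y ↦ TotalSpace.mk' F y (Y y)) x) :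
    MDifferentiableAt I (I.prod 𝓘(ℝ, F)) (fun y ↦ TotalSpace.mk' F y (J y (Y y))) x :=
  MDifferentiableAt.clm_bundle_apply ((hJ x).mdifferentiableAt (by simp)) hY

/-- The derivatives of `Y` cancel between the two terms, so $\nabla J$ depends on `Y` only through
its value at `x`. -/
theorem coord_derivEnd {D : Connection I N} {Γ : F → F →L[ℝ] F →L[ℝ] F}
    (hD : HasChristoffel D x₀ Γ) {J : EndField I N} (hJ : SmoothEnd J)
    (hx : x ∈ (chartAt H x₀).source) {Y : ∀ x : N, TangentSpace I x}
    (hY : MDifferentiableAt I (I.prod 𝓘(ℝ, F)) (fun y ↦ TotalSpace.mk' F y (Y y)) x)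
    (v : TangentSpace I x) :
    coord I x₀ x (derivEnd D J x v Y) =
      coordDerivEnd Γ (repEnd x₀ J) (extChartAt I x₀ x) (coord I x₀ x v) (coord I x₀ x (Y x)) := by
  have hmem := (isOpen_extChartAt_target (I := I) x₀).mem_nhds (extChartAt_mem_target hx)
  have he : repField x₀ (fun y ↦ J y (Y y)) =ᶠ[𝓝 (extChartAt I x₀ x)]
      fun z ↦ repEnd x₀ J z (repField x₀ Y z) := by
    filter_upwards [hmem] with y hy
    exact repField_comp hy J Y
  have hJd : DifferentiableAt ℝ (repEnd x₀ J) (extChartAt I x₀ x) :=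
    ((contDiffOn_repEnd hJ x₀).contDiffAt hmem).differentiableAt (by simp)
  have hd := hJd.hasFDerivAt.clm_apply (differentiableAt_repField hx hY).hasFDerivAt
  rw [derivEnd, map_sub, hD x hx _ (mdifferentiableAt_end hJ hY), he.fderiv_eq, hd.fderiv,
    ← repEnd_chart_coord hx, ← repEnd_chart_coord hx, hD x hx _ hY, coordDerivEnd,
    ← repField_chart hx Y]
  simp
  abel

theorem IsParallel.coordDerivEnd_eq_zero {D : Connection I N} {Γ : F → F →L[ℝ] F →L[ℝ] F}
    (hD : HasChristoffel D x₀ Γ) {J : EndField I N} (hJ : SmoothEnd J) (h : IsParallel D J)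
    (hz : z ∈ (extChartAt I x₀).target) (a b : F) :
    coordDerivEnd Γ (repEnd x₀ J) z a b = 0 := by
  obtain ⟨x, hx, rfl⟩ : ∃ x ∈ (chartAt H x₀).source, extChartAt I x₀ x = z :=
    ⟨_, extChartAt_symm_source hz, (extChartAt I x₀).right_inv hz⟩
  have hm := mdifferentiableAt_ofRepField (I := I) hx (differentiableAt_const (c := b) (𝕜 := ℝ))
  have h' := coord_derivEnd hD hJ hx hm (coordSymm I x₀ x a)
  rw [coord_ofRepField hx, coord_coordSymm hx, h _ _ _ hm, map_zero] at h'
  exact h'.symm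

/-- Every point is the centre of its own chart, so the identity is required only at centres. -/
theorem isParallel_of_coordDerivEnd {D : Connection I N} {J : EndField I N} (hJ : SmoothEnd J)
    (h : ∀ x₀ : N, ∃ Γ, HasChristoffel D x₀ Γ ∧
      ∀ a b, coordDerivEnd Γ (repEnd x₀ J) (extChartAt I x₀ x₀) a b = 0) :
    IsParallel D J := by
  intro x v Y hY
  obtain ⟨Γ, hD, h0⟩ := h x
  refine coord_injective (mem_chart_source H x) ?_
  rw [coord_derivEnd hD hJ (mem_chart_source H x) hY, h0, map_zero]

/-- Second derivatives of `Z` cancel by symmetry and first derivatives of `X` and `Y` cancel against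
the bracket; a tensorial expression remains. -/
theorem coord_curvature {D : Connection I N} {Γ : F → F →L[ℝ] F →L[ℝ] F}
    (hD : HasChristoffel D x₀ Γ) (hΓ : ContDiffOn ℝ ∞ Γ (extChartAt I x₀).target)
    (hx : x ∈ (chartAt H x₀).source) {X Y Z : ∀ x : N, TangentSpace I x}
    (hX : ContMDiffAt I (I.prod 𝓘(ℝ, F)) ∞ (fun y ↦ TotalSpace.mk' F y (X y)) x)
    (hY : ContMDiffAt I (I.prod 𝓘(ℝ, F)) ∞ (fun y ↦ TotalSpace.mk' F y (Y y)) x)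
    (hZ : ContMDiffAt I (I.prod 𝓘(ℝ, F)) ∞ (fun y ↦ TotalSpace.mk' F y (Z y)) x) :
    coord I x₀ x (curvature D X Y Z x) = coordCurvature Γ (extChartAt I x₀ x)
      (coord I x₀ x (X x)) (coord I x₀ x (Y x)) (coord I x₀ x (Z x)) := by
  have : CompleteSpace F := FiniteDimensional.complete ℝ F
  have hz := extChartAt_mem_target (I := I) hx
  have hmem := (isOpen_extChartAt_target (I := I) x₀).mem_nhds hz
  have hΓd : DifferentiableAt ℝ Γ (extChartAt I x₀ x) :=
    (hΓ.contDiffAt hmem).differentiableAt (by simp)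
  have hZc := contDiffAt_repField (n := ⊤) hx hZ
  have hZd : DifferentiableAt ℝ (repField x₀ Z) (extChartAt I x₀ x) :=
    hZc.differentiableAt (by simp)
  have hZ' : DifferentiableAt ℝ (fderiv ℝ (repField x₀ Z)) (extChartAt I x₀ x) :=
    (hZc.fderiv_right (m := ∞) (by simp)).differentiableAt (by simp)
  have hsymm := hZc.isSymmSndFDerivAt (by
    rw [minSmoothness_of_isRCLikeNormedField]; exact ENat.LEInfty.out)
  -- The coordinate formula for `D Z` is differentiated again, so it must hold in a neighbourhood;
  -- hence `Z` has to be differentiable near `x`.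
  have hnear : ∀ᶠ y in 𝓝 x, y ∈ (chartAt H x₀).source ∧
      MDifferentiableAt I (I.prod 𝓘(ℝ, F)) (fun y ↦ TotalSpace.mk' F y (Z y)) y := by
    filter_upwards [(chartAt H x₀).open_source.mem_nhds hx,
      contMDiffAt_iff_contMDiffAt_nhds (by simp) |>.1 (hZ.of_le (m := 1) ENat.LEInfty.out)] with y hy hy'
    exact ⟨hy, hy'.mdifferentiableAt (by simp)⟩
  have key : ∀ {X Y : ∀ x : N, TangentSpace I x},
      MDifferentiableAt I (I.prod 𝓘(ℝ, F)) (fun y ↦ TotalSpace.mk' F y (X y)) x →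
      MDifferentiableAt I (I.prod 𝓘(ℝ, F)) (fun y ↦ TotalSpace.mk' F y (Y y)) x →
      coord I x₀ x (D (fun y ↦ D Z y (Y y)) x (X x)) =
        fderiv ℝ (fderiv ℝ (repField x₀ Z)) (extChartAt I x₀ x) (coord I x₀ x (X x))
            (coord I x₀ x (Y x)) +
          fderiv ℝ (repField x₀ Z) (extChartAt I x₀ x)
            (fderiv ℝ (repField x₀ Y) (extChartAt I x₀ x) (coord I x₀ x (X x))) +
          fderiv ℝ Γ (extChartAt I x₀ x) (coord I x₀ x (X x)) (coord I x₀ x (Y x))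
            (coord I x₀ x (Z x)) +
          Γ (extChartAt I x₀ x)
            (fderiv ℝ (repField x₀ Y) (extChartAt I x₀ x) (coord I x₀ x (X x)))
            (coord I x₀ x (Z x)) +
          Γ (extChartAt I x₀ x) (coord I x₀ x (Y x))
            (fderiv ℝ (repField x₀ Z) (extChartAt I x₀ x) (coord I x₀ x (X x))) +
          Γ (extChartAt I x₀ x) (coord I x₀ x (X x))
            (fderiv ℝ (repField x₀ Z) (extChartAt I x₀ x) (coord I x₀ x (Y x))) +
          Γ (extChartAt I x₀ x) (coord I x₀ x (X x))
            (Γ (extChartAt I x₀ x) (coord I x₀ x (Y x)) (coord I x₀ x (Z x))) := by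
    intro X Y hX hY
    have hYd := differentiableAt_repField hx hY
    let W : F → F := fun z ↦ fderiv ℝ (repField x₀ Z) z (repField x₀ Y z) +
      Γ z (repField x₀ Y z) (repField x₀ Z z)
    have hW : ∀ᶠ y in 𝓝 x, coord I x₀ y (D Z y (Y y)) = W (extChartAt I x₀ y) := by
      filter_upwards [hnear] with y hy
      rw [hD y hy.1 Z hy.2]
      simp only [W, repField_chart hy.1]
    have hWd := (hZ'.hasFDerivAt.clm_apply hYd.hasFDerivAt).add
      ((hΓd.hasFDerivAt.clm_apply hYd.hasFDerivAt).clm_apply hZd.hasFDerivAt)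
    have hrep : repField x₀ (fun y ↦ D Z y (Y y)) =ᶠ[𝓝 (extChartAt I x₀ x)] W := by
      have hc : ContinuousAt (extChartAt I x₀).symm (extChartAt I x₀ x) :=
        (contMDiffAt_chart_symm hz).continuousAt
      have ht : Filter.Tendsto (extChartAt I x₀).symm (𝓝 (extChartAt I x₀ x)) (𝓝 x) := by
        have := hc.tendsto
        rwa [extChartAt_symm_extChartAt hx] at this
      filter_upwards [ht.eventually hW, hmem] with z h hz
      rw [(extChartAt I x₀).right_inv hz] at h
      exact h
    rw [hD x hx _ (mdifferentiableAt_of_coord hx hWd.differentiableAt hW), hrep.fderiv_eq,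
      hW.self_of_nhds]
    erw [hWd.fderiv]
    simp only [W, repField_chart hx, add_apply, ContinuousLinearMap.comp_apply,
      ContinuousLinearMap.flip_apply, map_add]
    abel
  have hXd := hX.mdifferentiableAt (by simp)
  have hYd := hY.mdifferentiableAt (by simp)
  rw [curvature, map_sub, map_sub, key hXd hYd, key hYd hXd, hD x hx Z
    (hZ.mdifferentiableAt (by simp)), coord_mlieBracket hx hXd hYd, coordCurvature]
  have e : fderiv ℝ (fderiv ℝ (repField x₀ Z)) (extChartAt I x₀ x) (coord I x₀ x (X x))
      (coord I x₀ x (Y x)) = _ := hsymm _ _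
  rw [e]
  simp only [map_sub, sub_apply]
  abel

theorem IsFlat.coordCurvature_eq_zero {D : Connection I N} {Γ : F → F →L[ℝ] F →L[ℝ] F}
    (hD : HasChristoffel D x₀ Γ) (hΓ : ContDiffOn ℝ ∞ Γ (extChartAt I x₀).target)
    (h : IsFlat D) (hz : z ∈ (extChartAt I x₀).target) (a b c : F) :
    coordCurvature Γ z a b c = 0 := by
  obtain ⟨x, hx, rfl⟩ : ∃ x ∈ (chartAt H x₀).source, extChartAt I x₀ x = z :=
    ⟨_, extChartAt_symm_source hz, (extChartAt I x₀).right_inv hz⟩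
  have hm (a : F) := contMDiffAt_ofRepField (I := I) (n := ⊤) hx (contDiffAt_const (c := a) (𝕜 := ℝ))
  have h' := coord_curvature hD hΓ hx (hm a) (hm b) (hm c)
  rw [coord_ofRepField hx, coord_ofRepField hx, coord_ofRepField hx,
    h x _ _ _ (hm a) (hm b) (hm c), map_zero] at h'
  exact h'.symm

theorem isFlat_of_coordCurvature {D : Connection I N}
    (h : ∀ x₀ : N, ∃ Γ, HasChristoffel D x₀ Γ ∧ ContDiffOn ℝ ∞ Γ (extChartAt I x₀).target ∧
      ∀ a b c, coordCurvature Γ (extChartAt I x₀ x₀) a b c = 0) :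
    IsFlat D := by
  intro x X Y Z hX hY hZ
  obtain ⟨Γ, hD, hΓ, h0⟩ := h x
  refine coord_injective (mem_chart_source H x) ?_
  rw [coord_curvature hD hΓ (mem_chart_source H x) hX hY hZ, h0, map_zero]

/-- An almost complex structure which is parallel for a Levi-Civita connection is integrable. -/
theorem isComplex_of_isParallel {g : FormField I N} (hg : IsPseudoRiemannian g)
    {J : EndField I N} (hJ : IsAlmostComplex J) (h : IsParallel (leviCivita g) J) :
    IsComplex J := by
  have : CompleteSpace F := FiniteDimensional.complete ℝ F
  refine ⟨hJ, fun x X Y hX hY ↦ ?_⟩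
  obtain ⟨cov, hcov, hcov'⟩ := leviCivita_spec hg
  rw [hcov'] at h
  have hT {X Y : ∀ x : N, TangentSpace I x} := (CovariantDerivative.torsion_eq_zero_iff cov).1
    hcov.torsion_free (X := X) (Y := Y) (x := x)
  have hP (v : TangentSpace I x) {Y : ∀ x : N, TangentSpace I x}
      (hY : MDifferentiableAt I (I.prod 𝓘(ℝ, F)) (fun y ↦ TotalSpace.mk' F y (Y y)) x) :
      cov.toFun (fun y ↦ J y (Y y)) x v = J x (cov.toFun Y x v) := sub_eq_zero.1 (h x v Y hY)
  have hJX := mdifferentiableAt_end hJ.smooth hX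
  have hJY := mdifferentiableAt_end hJ.smooth hY
  rw [nijenhuis, ← hT hX hY, ← hT hJX hY, ← hT hX hJY, ← hT hJX hJY]
  simp only [hP _ hX, hP _ hY, map_sub, hJ.sq]
  abel

end Parallel

/-! ### The complete lift and the lifted endomorphisms in induced coordinates. -/

section LiftModel

variable {E : Type*} [NormedAddCommGroup E] [NormedSpace ℝ E]

/-- The coordinate expression `(a, b) ↦ (a, b + Γ(a, w))` of the horizontal and vertical parts at
the point `p = (z, w)`. -/
def coordParts (Γ : E → E →L[ℝ] E →L[ℝ] E) (p : E × E) : E × E →L[ℝ] E × E :=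
  (ContinuousLinearMap.fst ℝ E E).prod
    (ContinuousLinearMap.snd ℝ E E + (Γ p.1).flip p.2 ∘L ContinuousLinearMap.fst ℝ E E)

/-- The inverse `(a, b) ↦ (a, b - Γ(a, w))` of `coordParts`. -/
def coordPartsSymm (Γ : E → E →L[ℝ] E →L[ℝ] E) (p : E × E) : E × E →L[ℝ] E × E :=
  (ContinuousLinearMap.fst ℝ E E).prod
    (ContinuousLinearMap.snd ℝ E E - (Γ p.1).flip p.2 ∘L ContinuousLinearMap.fst ℝ E E)

theorem coordParts_apply (Γ : E → E →L[ℝ] E →L[ℝ] E) (p V : E × E) :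
    coordParts Γ p V = (V.1, V.2 + Γ p.1 V.1 p.2) := rfl

theorem coordPartsSymm_apply (Γ : E → E →L[ℝ] E →L[ℝ] E) (p V : E × E) :
    coordPartsSymm Γ p V = (V.1, V.2 - Γ p.1 V.1 p.2) := rfl

theorem coordParts_coordPartsSymm (Γ : E → E →L[ℝ] E →L[ℝ] E) (p V : E × E) :
    coordParts Γ p (coordPartsSymm Γ p V) = V := by
  simp [coordParts_apply, coordPartsSymm_apply]

theorem coordPartsSymm_coordParts (Γ : E → E →L[ℝ] E →L[ℝ] E) (p V : E × E) :
    coordPartsSymm Γ p (coordParts Γ p V) = V := by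
  simp [coordParts_apply, coordPartsSymm_apply]

/-- The coordinate expression of the complete lift of the metric `g`. -/
def liftMetric (g : E → E →L[ℝ] E →L[ℝ] ℝ) (p : E × E) : E × E →L[ℝ] E × E →L[ℝ] ℝ :=
  (fderiv ℝ g p.1 p.2).bilinearComp (ContinuousLinearMap.fst ℝ E E)
      (ContinuousLinearMap.fst ℝ E E) +
    (g p.1).bilinearComp (ContinuousLinearMap.fst ℝ E E) (ContinuousLinearMap.snd ℝ E E) +
    (g p.1).bilinearComp (ContinuousLinearMap.snd ℝ E E) (ContinuousLinearMap.fst ℝ E E)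

theorem liftMetric_apply (g : E → E →L[ℝ] E →L[ℝ] ℝ) (p V W : E × E) :
    liftMetric g p V W = fderiv ℝ g p.1 p.2 V.1 W.1 + g p.1 V.1 W.2 + g p.1 V.2 W.1 := rfl

/-- The Christoffel symbols of the complete lift. -/
def liftChristoffel (Γ : E → E →L[ℝ] E →L[ℝ] E) (p : E × E) : E × E →L[ℝ] E × E →L[ℝ] E × E :=
  (ContinuousLinearMap.compL ℝ (E × E) E (E × E) (ContinuousLinearMap.inl ℝ E E)).comp
      ((Γ p.1).bilinearComp (ContinuousLinearMap.fst ℝ E E) (ContinuousLinearMap.fst ℝ E E)) +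
    (ContinuousLinearMap.compL ℝ (E × E) E (E × E) (ContinuousLinearMap.inr ℝ E E)).comp
      ((fderiv ℝ Γ p.1 p.2).bilinearComp (ContinuousLinearMap.fst ℝ E E)
          (ContinuousLinearMap.fst ℝ E E) +
        (Γ p.1).bilinearComp (ContinuousLinearMap.snd ℝ E E) (ContinuousLinearMap.fst ℝ E E) +
        (Γ p.1).bilinearComp (ContinuousLinearMap.fst ℝ E E) (ContinuousLinearMap.snd ℝ E E))

theorem liftChristoffel_apply (Γ : E → E →L[ℝ] E →L[ℝ] E) (p V W : E × E) :
    liftChristoffel Γ p V W = (Γ p.1 V.1 W.1,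
      fderiv ℝ Γ p.1 p.2 V.1 W.1 + Γ p.1 V.2 W.1 + Γ p.1 V.1 W.2) := by
  simp [liftChristoffel]

variable {g : E → E →L[ℝ] E →L[ℝ] ℝ} {Γ : E → E →L[ℝ] E →L[ℝ] E} {J : E → E →L[ℝ] E} {U : Set E}
  {p : E × E}

section Smooth

variable [FiniteDimensional ℝ E]

theorem contDiffOn_comp_fst {G : Type*} [NormedAddCommGroup G] [NormedSpace ℝ G] {f : E → G}
    (hf : ContDiffOn ℝ ∞ f U) : ContDiffOn ℝ ∞ (fun p : E × E ↦ f p.1) (U ×ˢ Set.univ) :=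
  hf.comp contDiffOn_fst fun _ hp ↦ hp.1

theorem contDiffOn_liftMetric (hU : IsOpen U) (hg : ContDiffOn ℝ ∞ g U) :
    ContDiffOn ℝ ∞ (liftMetric g) (U ×ˢ Set.univ) := by
  rw [contDiffOn_clm_apply]
  intro V
  rw [contDiffOn_clm_apply]
  intro W
  simp only [liftMetric_apply]
  have hg' := contDiffOn_comp_fst hg
  have hD := contDiffOn_comp_fst (hg.fderiv_of_isOpen (m := ∞) hU (by simp))
  exact ((((hD.clm_apply contDiffOn_snd).clm_apply contDiffOn_const).clm_apply
    contDiffOn_const).add ((hg'.clm_apply contDiffOn_const).clm_apply contDiffOn_const)).add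
    ((hg'.clm_apply contDiffOn_const).clm_apply contDiffOn_const)

theorem contDiffOn_coordParts (hΓ : ContDiffOn ℝ ∞ Γ U) :
    ContDiffOn ℝ ∞ (coordParts Γ) (U ×ˢ Set.univ) := by
  rw [contDiffOn_clm_apply]
  intro V
  simp only [coordParts_apply]
  exact contDiffOn_const.prodMk (contDiffOn_const.add
    (((contDiffOn_comp_fst hΓ).clm_apply contDiffOn_const).clm_apply contDiffOn_snd))

theorem contDiffOn_coordPartsSymm (hΓ : ContDiffOn ℝ ∞ Γ U) :
    ContDiffOn ℝ ∞ (coordPartsSymm Γ) (U ×ˢ Set.univ) := by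
  rw [contDiffOn_clm_apply]
  intro V
  simp only [coordPartsSymm_apply]
  exact contDiffOn_const.prodMk (contDiffOn_const.sub
    (((contDiffOn_comp_fst hΓ).clm_apply contDiffOn_const).clm_apply contDiffOn_snd))

/-- Both metric and symbols of the lift are built from those on the base and their derivatives along
$w$. The compatibility equation upstairs thus combines the one downstairs with its derivative along
$w$. -/
theorem isChristoffel_lift (hU : IsOpen U) (hg : ContDiffOn ℝ ∞ g U) (hΓ : ContDiffOn ℝ ∞ Γ U)
    (h : ∀ z ∈ U, IsChristoffel g Γ z) (hp : p.1 ∈ U) :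
    IsChristoffel (liftMetric g) (liftChristoffel Γ) p := by
  have hmem := hU.mem_nhds hp
  have hgd : DifferentiableAt ℝ g p.1 := (hg.contDiffAt hmem).differentiableAt (by simp)
  have hΓd : DifferentiableAt ℝ Γ p.1 := (hΓ.contDiffAt hmem).differentiableAt (by simp)
  have hDd : DifferentiableAt ℝ (fderiv ℝ g) p.1 :=
    ((hg.contDiffAt hmem).fderiv_right (m := ∞) (by simp)).differentiableAt (by simp)
  have hΓs := fderiv_bilin_symm hΓd (by
    filter_upwards [hmem] with y hy using (h y hy).symm)
  have hp' := (hU.prod isOpen_univ).mem_nhds (Set.mk_mem_prod hp (Set.mem_univ p.2))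
  have hLd : DifferentiableAt ℝ (liftMetric g) p :=
    ((contDiffOn_liftMetric hU hg).contDiffAt hp').differentiableAt (by simp)
  have hsymm := (hg.contDiffAt hmem).isSymmSndFDerivAt (by
    rw [minSmoothness_of_isRCLikeNormedField]; exact ENat.LEInfty.out)
  constructor
  · intro V W
    rw [liftChristoffel_apply, liftChristoffel_apply, (h _ hp).symm W.1, hΓs _ W.1,
      (h _ hp).symm V.1 W.2, (h _ hp).symm V.2 W.1]
    congr 1
    abel
  · intro V W Z
    have e1 : fderiv ℝ (liftMetric g) p V W Z = fderiv ℝ (fderiv ℝ g) p.1 V.1 p.2 W.1 Z.1 +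
        fderiv ℝ g p.1 V.2 W.1 Z.1 + fderiv ℝ g p.1 V.1 W.1 Z.2 + fderiv ℝ g p.1 V.1 W.2 Z.1 := by
      rw [← fderiv_clm_apply_const hLd,
        ← fderiv_clm_apply_const (hLd.clm_apply (differentiableAt_const W))]
      simp only [liftMetric_apply]
      have h1 := hgd.hasFDerivAt.comp p hasFDerivAt_fst
      have h2 := hDd.hasFDerivAt.comp p hasFDerivAt_fst
      have hc (X : E) := hasFDerivAt_const X p (𝕜 := ℝ)
      have h3 := ((((h2.clm_apply hasFDerivAt_snd).clm_apply (hc W.1)).clm_apply (hc Z.1)).add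
        ((h1.clm_apply (hc W.1)).clm_apply (hc Z.2))).add
        ((h1.clm_apply (hc W.2)).clm_apply (hc Z.1))
      have h4 := congrArg (fun L : E × E →L[ℝ] ℝ ↦ L V) h3.fderiv
      refine h4.trans ?_
      simp
      ring
    -- Exchange the two derivatives of `g`, then differentiate the compatibility equation in the
    -- fibre direction `p.2`.
    have e2 : fderiv ℝ (fderiv ℝ g) p.1 V.1 p.2 W.1 Z.1 =
        fderiv ℝ g p.1 p.2 (Γ p.1 V.1 W.1) Z.1 + g p.1 (fderiv ℝ Γ p.1 p.2 V.1 W.1) Z.1 +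
          fderiv ℝ g p.1 p.2 W.1 (Γ p.1 V.1 Z.1) + g p.1 W.1 (fderiv ℝ Γ p.1 p.2 V.1 Z.1) := by
      have e3 : fderiv ℝ (fderiv ℝ g) p.1 V.1 p.2 = fderiv ℝ (fderiv ℝ g) p.1 p.2 V.1 :=
        hsymm _ _
      rw [e3, ← fderiv_clm_apply_const hDd,
        ← fderiv_clm_apply_const (hDd.clm_apply (differentiableAt_const _)),
        ← fderiv_clm_apply_const ((hDd.clm_apply (differentiableAt_const _)).clm_apply
          (differentiableAt_const _))]
      have he : (fun z ↦ fderiv ℝ g z V.1 W.1 Z.1) =ᶠ[𝓝 p.1]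
          fun z ↦ g z (Γ z V.1 W.1) Z.1 + g z W.1 (Γ z V.1 Z.1) := by
        filter_upwards [hmem] with y hy using (h y hy).compat _ _ _
      rw [he.fderiv_eq]
      have hc (X : E) := hasFDerivAt_const X p.1 (𝕜 := ℝ)
      have h1 (X : E) := (hΓd.hasFDerivAt.clm_apply (hc V.1)).clm_apply (hc X)
      have h3 := ((hgd.hasFDerivAt.clm_apply (h1 W.1)).clm_apply (hc Z.1)).add
        ((hgd.hasFDerivAt.clm_apply (hc W.1)).clm_apply (h1 Z.1))
      refine (congrArg (fun L : E →L[ℝ] ℝ ↦ L p.2) h3.fderiv).trans ?_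
      simp
      ring
    rw [e1, e2]
    simp only [liftMetric_apply, liftChristoffel_apply, (h _ hp).compat, map_add, add_apply]
    ring

/-- In terms of horizontal and vertical parts, `(c, d)` being the direction of differentiation, the
connection form of the complete lift is `(a, b) ↦ (Γ(c, a), Γ(c, b) + R(w, c) a)`. -/
theorem coordParts_liftChristoffel (hU : IsOpen U) (hΓ : ContDiffOn ℝ ∞ Γ U)
    (hs : ∀ z ∈ U, ∀ a b, Γ z a b = Γ z b a) (hp : p.1 ∈ U) (V W : E × E) :
    coordParts Γ p (liftChristoffel Γ p V W) - fderiv ℝ (coordParts Γ) p V W =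
      (Γ p.1 V.1 (coordParts Γ p W).1, Γ p.1 V.1 (coordParts Γ p W).2 +
        coordCurvature Γ p.1 p.2 V.1 (coordParts Γ p W).1) := by
  have hmem := hU.mem_nhds hp
  have hp' := (hU.prod isOpen_univ).mem_nhds (Set.mk_mem_prod hp (Set.mem_univ p.2))
  have hΓd : DifferentiableAt ℝ Γ p.1 := (hΓ.contDiffAt hmem).differentiableAt (by simp)
  have hΓs := fderiv_bilin_symm hΓd (by filter_upwards [hmem] with y hy using hs y hy)
  have hPd : DifferentiableAt ℝ (coordParts Γ) p :=
    ((contDiffOn_coordParts hΓ).contDiffAt hp').differentiableAt (by simp)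
  have e : fderiv ℝ (coordParts Γ) p V W =
      (0, fderiv ℝ Γ p.1 V.1 W.1 p.2 + Γ p.1 W.1 V.2) := by
    rw [← fderiv_clm_apply_const hPd]
    simp only [coordParts_apply]
    have h1 := (hΓd.hasFDerivAt.comp p hasFDerivAt_fst).clm_apply (hasFDerivAt_const W.1 p)
    have h2 := (hasFDerivAt_const W.1 p).prodMk
      ((hasFDerivAt_const W.2 p).add (h1.clm_apply hasFDerivAt_snd))
    refine (congrArg (fun L : E × E →L[ℝ] E × E ↦ L V) h2.fderiv).trans ?_
    simp [add_comm]
  rw [e]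
  simp only [coordParts_apply, liftChristoffel_apply, coordCurvature, Prod.mk_sub_mk, sub_zero,
    map_add]
  -- Symmetry of `Γ` cancels the terms in the vertical coordinate `V.2`; symmetry of its derivative
  -- brings the rest to the form of the curvature.
  rw [hΓs V.1 W.1, hs _ hp (Γ p.1 V.1 W.1), hs _ hp W.1 V.2, hs _ hp W.1 p.2]
  congr 1
  abel

/-- The covariant derivative of a field of endomorphisms in terms of horizontal and vertical
parts. -/
theorem coordParts_coordDerivEnd (hU : IsOpen U) (hΓ : ContDiffOn ℝ ∞ Γ U)
    (hs : ∀ z ∈ U, ∀ a b, Γ z a b = Γ z b a) (hp : p.1 ∈ U)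
    {S K : E × E → E × E →L[ℝ] E × E} (hS : DifferentiableAt ℝ S p) (hK : DifferentiableAt ℝ K p)
    (hSK : ∀ q : E × E, q.1 ∈ U → ∀ W, coordParts Γ q (K q W) = S q (coordParts Γ q W))
    (V W : E × E) :
    coordParts Γ p (coordDerivEnd (liftChristoffel Γ) K p V W) =
      fderiv ℝ S p V (coordParts Γ p W) +
        (Γ p.1 V.1 (S p (coordParts Γ p W)).1, Γ p.1 V.1 (S p (coordParts Γ p W)).2 +
          coordCurvature Γ p.1 p.2 V.1 (S p (coordParts Γ p W)).1) -
        S p (Γ p.1 V.1 (coordParts Γ p W).1, Γ p.1 V.1 (coordParts Γ p W).2 +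
          coordCurvature Γ p.1 p.2 V.1 (coordParts Γ p W).1) := by
  have hp' := (hU.prod isOpen_univ).mem_nhds (Set.mk_mem_prod hp (Set.mem_univ p.2))
  have hPd : DifferentiableAt ℝ (coordParts Γ) p :=
    ((contDiffOn_coordParts hΓ).contDiffAt hp').differentiableAt (by simp)
  have hc := hasFDerivAt_const W p (𝕜 := ℝ)
  have h1 := (hPd.hasFDerivAt.clm_apply (hK.hasFDerivAt.clm_apply hc))
  have h2 := (hS.hasFDerivAt.clm_apply (hPd.hasFDerivAt.clm_apply hc))
  -- Leibniz rule applied to both sides of $PK=SP$, where $P$ is `coordParts Γ`. It replaces the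
  -- derivative of `K` by those of `S` and `P`.
  have h3 := h1.unique (h2.congr_of_eventuallyEq (by
    filter_upwards [hp'] with q hq using hSK q hq.1 W))
  have h4 := congrArg (fun L : E × E →L[ℝ] E × E ↦ L V) h3
  simp only [add_apply, ContinuousLinearMap.comp_apply, ContinuousLinearMap.flip_apply,
    zero_apply, map_zero, zero_add] at h4
  have h5 := eq_sub_of_add_eq h4
  rw [coordDerivEnd, map_sub, map_add, h5, hSK p hp, ← hSK p hp W,
    ← coordParts_liftChristoffel hU hΓ hs hp, ← coordParts_liftChristoffel hU hΓ hs hp, map_sub]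
  abel

end Smooth

/-- `(a, b) ↦ (-A a, A b)`. -/
def frameJ₁ (A : E →L[ℝ] E) : E × E →L[ℝ] E × E :=
  (-(A ∘L ContinuousLinearMap.fst ℝ E E)).prod (A ∘L ContinuousLinearMap.snd ℝ E E)

/-- `(a, b) ↦ (-b, a)`. -/
def frameJ₂ : E × E →L[ℝ] E × E :=
  (-ContinuousLinearMap.snd ℝ E E).prod (ContinuousLinearMap.fst ℝ E E)

/-- `(a, b) ↦ (A b, A a)`. -/
def frameJ₃ (A : E →L[ℝ] E) : E × E →L[ℝ] E × E :=
  (A ∘L ContinuousLinearMap.snd ℝ E E).prod (A ∘L ContinuousLinearMap.fst ℝ E E)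

theorem frameJ₁_apply (A : E →L[ℝ] E) (V : E × E) : frameJ₁ A V = (-A V.1, A V.2) := rfl

theorem frameJ₂_apply (V : E × E) : frameJ₂ V = (-V.2, V.1) := rfl

theorem frameJ₃_apply (A : E →L[ℝ] E) (V : E × E) : frameJ₃ A V = (A V.2, A V.1) := rfl

section Smooth

variable [FiniteDimensional ℝ E]

theorem contDiffOn_frameJ₁ (hJ : ContDiffOn ℝ ∞ J U) :
    ContDiffOn ℝ ∞ (fun p : E × E ↦ frameJ₁ (J p.1)) (U ×ˢ Set.univ) := by
  rw [contDiffOn_clm_apply]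
  intro V
  have h := contDiffOn_comp_fst hJ
  exact ((h.clm_apply contDiffOn_const).neg).prodMk (h.clm_apply contDiffOn_const)

theorem contDiffOn_frameJ₃ (hJ : ContDiffOn ℝ ∞ J U) :
    ContDiffOn ℝ ∞ (fun p : E × E ↦ frameJ₃ (J p.1)) (U ×ˢ Set.univ) := by
  rw [contDiffOn_clm_apply]
  intro V
  have h := contDiffOn_comp_fst hJ
  exact (h.clm_apply contDiffOn_const).prodMk (h.clm_apply contDiffOn_const)

theorem fderiv_frameJ₁ (hJ : DifferentiableAt ℝ J p.1)
    (h : DifferentiableAt ℝ (fun q : E × E ↦ frameJ₁ (J q.1)) p) (V W : E × E) :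
    fderiv ℝ (fun q : E × E ↦ frameJ₁ (J q.1)) p V W = frameJ₁ (fderiv ℝ J p.1 V.1) W := by
  rw [← fderiv_clm_apply_const h]
  have h' (X : E) := (hJ.hasFDerivAt.comp p hasFDerivAt_fst).clm_apply (hasFDerivAt_const X p)
  refine (congrArg (fun L : E × E →L[ℝ] E × E ↦ L V)
    ((h' W.1).neg.prodMk (h' W.2)).fderiv).trans ?_
  simp [frameJ₁_apply]

theorem fderiv_frameJ₃ (hJ : DifferentiableAt ℝ J p.1)
    (h : DifferentiableAt ℝ (fun q : E × E ↦ frameJ₃ (J q.1)) p) (V W : E × E) :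
    fderiv ℝ (fun q : E × E ↦ frameJ₃ (J q.1)) p V W = frameJ₃ (fderiv ℝ J p.1 V.1) W := by
  rw [← fderiv_clm_apply_const h]
  have h' (X : E) := (hJ.hasFDerivAt.comp p hasFDerivAt_fst).clm_apply (hasFDerivAt_const X p)
  refine (congrArg (fun L : E × E →L[ℝ] E × E ↦ L V)
    ((h' W.2).prodMk (h' W.1)).fderiv).trans ?_
  simp [frameJ₃_apply]

/-- The field of endomorphisms given by `S` in terms of horizontal and vertical parts. -/
def liftEnd (Γ : E → E →L[ℝ] E →L[ℝ] E) (S : E × E → E × E →L[ℝ] E × E) (p : E × E) :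
    E × E →L[ℝ] E × E :=
  coordPartsSymm Γ p ∘L S p ∘L coordParts Γ p

theorem coordParts_liftEnd (Γ : E → E →L[ℝ] E →L[ℝ] E) (S : E × E → E × E →L[ℝ] E × E)
    (p V : E × E) : coordParts Γ p (liftEnd Γ S p V) = S p (coordParts Γ p V) :=
  coordParts_coordPartsSymm _ _ _

theorem contDiffOn_liftEnd (hΓ : ContDiffOn ℝ ∞ Γ U) {S : E × E → E × E →L[ℝ] E × E}
    (hS : ContDiffOn ℝ ∞ S (U ×ˢ Set.univ)) :
    ContDiffOn ℝ ∞ (liftEnd Γ S) (U ×ˢ Set.univ) :=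
  (contDiffOn_coordPartsSymm hΓ).clm_comp (hS.clm_comp (contDiffOn_coordParts hΓ))

theorem coordParts_coordDerivEnd_liftEnd (hU : IsOpen U) (hΓ : ContDiffOn ℝ ∞ Γ U)
    (hs : ∀ z ∈ U, ∀ a b, Γ z a b = Γ z b a) (hp : p.1 ∈ U)
    {S : E × E → E × E →L[ℝ] E × E} (hS : ContDiffOn ℝ ∞ S (U ×ˢ Set.univ)) (V W : E × E) :
    coordParts Γ p (coordDerivEnd (liftChristoffel Γ) (liftEnd Γ S) p V (coordPartsSymm Γ p W)) =
      fderiv ℝ S p V W +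
        (Γ p.1 V.1 (S p W).1, Γ p.1 V.1 (S p W).2 + coordCurvature Γ p.1 p.2 V.1 (S p W).1) -
        S p (Γ p.1 V.1 W.1, Γ p.1 V.1 W.2 + coordCurvature Γ p.1 p.2 V.1 W.1) := by
  have hp' := (hU.prod isOpen_univ).mem_nhds (Set.mk_mem_prod hp (Set.mem_univ p.2))
  rw [coordParts_coordDerivEnd hU hΓ hs hp ((hS.contDiffAt hp').differentiableAt (by simp))
    (((contDiffOn_liftEnd hΓ hS).contDiffAt hp').differentiableAt (by simp))
    (fun q _ W ↦ coordParts_liftEnd Γ S q W), coordParts_coordPartsSymm]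

/-- `coordParts Γ p` is invertible, so vanishing may be tested with both the argument and the value
in horizontal and vertical parts. -/
theorem coordDerivEnd_liftEnd_eq_zero_iff (p : E × E) (S : E × E → E × E →L[ℝ] E × E) :
    (∀ V W, coordDerivEnd (liftChristoffel Γ) (liftEnd Γ S) p V W = 0) ↔
      ∀ V W, coordParts Γ p
        (coordDerivEnd (liftChristoffel Γ) (liftEnd Γ S) p V (coordPartsSymm Γ p W)) = 0 := by
  constructor
  · intro h V W
    rw [h, map_zero]
  · intro h V W
    have h' := h V (coordParts Γ p W)
    rw [coordPartsSymm_coordParts] at h'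
    rw [← coordPartsSymm_coordParts Γ p (coordDerivEnd _ _ _ _ _), h', map_zero]

/-- The diagonal blocks of the derivative are $\mp\nabla J$; the lower left one is $-(RJ+JR)$,
because $J$ enters with opposite signs on the two parts. -/
theorem coordDerivEnd_liftJ₁ (hU : IsOpen U) (hΓ : ContDiffOn ℝ ∞ Γ U)
    (hs : ∀ z ∈ U, ∀ a b, Γ z a b = Γ z b a) (hJ : ContDiffOn ℝ ∞ J U) (hp : p.1 ∈ U) :
    (∀ V W, coordDerivEnd (liftChristoffel Γ) (liftEnd Γ fun q ↦ frameJ₁ (J q.1)) p V W = 0) ↔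
      (∀ c a, coordDerivEnd Γ J p.1 c a = 0) ∧ ∀ c a,
        coordCurvature Γ p.1 p.2 c (J p.1 a) + J p.1 (coordCurvature Γ p.1 p.2 c a) = 0 := by
  have hS := contDiffOn_frameJ₁ hJ
  have hp' := (hU.prod isOpen_univ).mem_nhds (Set.mk_mem_prod hp (Set.mem_univ p.2))
  have hJd : DifferentiableAt ℝ J p.1 :=
    (hJ.contDiffAt (hU.mem_nhds hp)).differentiableAt (by simp)
  have hRn (a b c : E) : coordCurvature Γ p.1 a b (-c) = -coordCurvature Γ p.1 a b c := by
    simp [coordCurvature]; abel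
  have hD0 (c : E) : coordDerivEnd Γ J p.1 c 0 = 0 := by simp [coordDerivEnd]
  have key : ∀ V W : E × E, coordParts Γ p (coordDerivEnd (liftChristoffel Γ)
      (liftEnd Γ fun q ↦ frameJ₁ (J q.1)) p V (coordPartsSymm Γ p W)) =
      (-coordDerivEnd Γ J p.1 V.1 W.1, coordDerivEnd Γ J p.1 V.1 W.2 -
        (coordCurvature Γ p.1 p.2 V.1 (J p.1 W.1) + J p.1 (coordCurvature Γ p.1 p.2 V.1 W.1))) := by
    intro V W
    rw [coordParts_coordDerivEnd_liftEnd hU hΓ hs hp hS,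
      fderiv_frameJ₁ hJd ((hS.contDiffAt hp').differentiableAt (by simp))]
    simp only [frameJ₁_apply, coordDerivEnd, Prod.mk_add_mk, Prod.mk_sub_mk, map_add, map_neg, hRn]
    congr 1 <;> abel
  rw [coordDerivEnd_liftEnd_eq_zero_iff]
  simp only [key, Prod.mk_eq_zero]
  constructor
  · intro h
    -- A horizontal argument `(a, 0)` isolates both blocks: its first component is $-\nabla J$, its
    -- second the curvature term.
    refine ⟨fun c a ↦ neg_eq_zero.1 (h (c, 0) (a, 0)).1, fun c a ↦ ?_⟩
    have := (h (c, 0) (a, 0)).2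
    rwa [hD0, zero_sub, neg_eq_zero] at this
  · intro h V W
    rw [h.1, h.1, h.2]
    simp

/-- The matrix of $J_2$ is constant and commutes with the two copies of `Γ`; only its commutator
with the curvature term survives. -/
theorem coordDerivEnd_liftJ₂ (hU : IsOpen U) (hΓ : ContDiffOn ℝ ∞ Γ U)
    (hs : ∀ z ∈ U, ∀ a b, Γ z a b = Γ z b a) (hp : p.1 ∈ U) :
    (∀ V W, coordDerivEnd (liftChristoffel Γ) (liftEnd Γ fun _ ↦ frameJ₂) p V W = 0) ↔
      ∀ c a, coordCurvature Γ p.1 p.2 c a = 0 := by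
  have hRn (a b c : E) : coordCurvature Γ p.1 a b (-c) = -coordCurvature Γ p.1 a b c := by
    simp [coordCurvature]; abel
  have key : ∀ V W : E × E, coordParts Γ p (coordDerivEnd (liftChristoffel Γ)
      (liftEnd Γ fun _ ↦ frameJ₂) p V (coordPartsSymm Γ p W)) =
      (coordCurvature Γ p.1 p.2 V.1 W.1, -coordCurvature Γ p.1 p.2 V.1 W.2) := by
    intro V W
    rw [coordParts_coordDerivEnd_liftEnd hU hΓ hs hp contDiffOn_const, fderiv_fun_const]
    simp only [frameJ₂_apply, Pi.zero_apply, zero_apply, zero_add, Prod.mk_sub_mk, map_neg, hRn]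
    congr 1 <;> abel
  rw [coordDerivEnd_liftEnd_eq_zero_iff]
  simp only [key, Prod.mk_eq_zero]
  constructor
  · exact fun h c a ↦ (h (c, 0) (a, 0)).1
  · intro h V W
    simp [h]

/-- Here $\nabla J$ fills the off-diagonal blocks, while the commutator with the curvature term has
diagonal blocks $-JR$ and $RJ$, so the conditions separate. -/
theorem coordDerivEnd_liftJ₃ (hU : IsOpen U) (hΓ : ContDiffOn ℝ ∞ Γ U)
    (hs : ∀ z ∈ U, ∀ a b, Γ z a b = Γ z b a) (hJ : ContDiffOn ℝ ∞ J U) (hp : p.1 ∈ U) :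
    (∀ V W, coordDerivEnd (liftChristoffel Γ) (liftEnd Γ fun q ↦ frameJ₃ (J q.1)) p V W = 0) ↔
      (∀ c a, coordDerivEnd Γ J p.1 c a = 0) ∧
      (∀ c a, J p.1 (coordCurvature Γ p.1 p.2 c a) = 0) ∧
      ∀ c a, coordCurvature Γ p.1 p.2 c (J p.1 a) = 0 := by
  have hS := contDiffOn_frameJ₃ hJ
  have hp' := (hU.prod isOpen_univ).mem_nhds (Set.mk_mem_prod hp (Set.mem_univ p.2))
  have hJd : DifferentiableAt ℝ J p.1 :=
    (hJ.contDiffAt (hU.mem_nhds hp)).differentiableAt (by simp)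
  have hR0 (a b : E) : coordCurvature Γ p.1 a b 0 = 0 := by simp [coordCurvature]
  have hD0 (c : E) : coordDerivEnd Γ J p.1 c 0 = 0 := by simp [coordDerivEnd]
  have key : ∀ V W : E × E, coordParts Γ p (coordDerivEnd (liftChristoffel Γ)
      (liftEnd Γ fun q ↦ frameJ₃ (J q.1)) p V (coordPartsSymm Γ p W)) =
      (coordDerivEnd Γ J p.1 V.1 W.2 - J p.1 (coordCurvature Γ p.1 p.2 V.1 W.1),
        coordDerivEnd Γ J p.1 V.1 W.1 + coordCurvature Γ p.1 p.2 V.1 (J p.1 W.2)) := by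
    intro V W
    rw [coordParts_coordDerivEnd_liftEnd hU hΓ hs hp hS,
      fderiv_frameJ₃ hJd ((hS.contDiffAt hp').differentiableAt (by simp))]
    simp only [frameJ₃_apply, coordDerivEnd, Prod.mk_add_mk, Prod.mk_sub_mk, map_add]
    congr 1 <;> abel
  rw [coordDerivEnd_liftEnd_eq_zero_iff]
  simp only [key, Prod.mk_eq_zero]
  constructor
  · intro h
    have h1 (c a : E) : coordDerivEnd Γ J p.1 c a = 0 := by
      have := (h (c, 0) (a, 0)).2
      rwa [map_zero, hR0, add_zero] at this
    refine ⟨h1, fun c a ↦ ?_, fun c a ↦ ?_⟩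
    · have := (h (c, 0) (a, 0)).1
      rwa [h1, zero_sub, neg_eq_zero] at this
    · have := (h (c, 0) (a, a)).2
      rwa [h1, zero_add] at this
  · rintro ⟨h1, h2, h3⟩ V W
    rw [h1, h1, h2, h3]
    simp

end Smooth

end LiftModel

/-! ### Horizontal and vertical lifts in the induced chart of $TM$. -/

section TangentCoordinates

variable {E : Type*} [NormedAddCommGroup E] [NormedSpace ℝ E] [FiniteDimensional ℝ E]
  {M : Type*} [TopologicalSpace M] [ChartedSpace E M] [IsManifold 𝓘(ℝ, E) ∞ M]
  {u₀ u : TangentBundle 𝓘(ℝ, E) M} {D : Connection 𝓘(ℝ, E) M} {Γ : E → E →L[ℝ] E →L[ℝ] E}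

theorem extChartAt_tangent (hu : u.proj ∈ (chartAt E u₀.proj).source) :
    extChartAt 𝓘(ℝ, E).tangent u₀ u =
      (extChartAt 𝓘(ℝ, E) u₀.proj u.proj, coord 𝓘(ℝ, E) u₀.proj u.proj u.snd) := by
  refine Prod.ext rfl ?_
  exact trivializationAt_snd (I := 𝓘(ℝ, E)) hu u.snd

theorem mem_extChartAt_tangent_target {p : E × E} :
    p ∈ (extChartAt 𝓘(ℝ, E).tangent u₀).target ↔
      p.1 ∈ (extChartAt 𝓘(ℝ, E) u₀.proj).target := by
  rw [extChartAt_target, extChartAt_target, ModelWithCorners.range_eq_univ,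
    ModelWithCorners.range_eq_univ, Set.inter_univ, Set.inter_univ]
  exact TangentBundle.mem_chart_target_iff (I := 𝓘(ℝ, E)) p u₀

/-- Along a fibre the induced chart is constant in the base coordinate and linear in the fibre
coordinate. -/
theorem coord_verticalLift (hu : u.proj ∈ (chartAt E u₀.proj).source)
    (b : TangentSpace 𝓘(ℝ, E) u.proj) :
    coord 𝓘(ℝ, E).tangent u₀ u (verticalLift u b) = (0, coord 𝓘(ℝ, E) u₀.proj u.proj b) := by
  have hu' := (TangentBundle.mem_chart_source_iff (I := 𝓘(ℝ, E)) u u₀).2 hu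
  have hd : MDifferentiableAt 𝓘(ℝ, E).tangent 𝓘(ℝ, E × E) (extChartAt 𝓘(ℝ, E).tangent u₀) u :=
    (contMDiffAt_chart (I := 𝓘(ℝ, E).tangent) hu').mdifferentiableAt (by simp)
  have h := mfderiv_comp (I := 𝓘(ℝ, E)) (M := E) (g := extChartAt 𝓘(ℝ, E).tangent u₀)
    (f := fun w : E ↦ (TotalSpace.mk' E u.proj w : TangentBundle 𝓘(ℝ, E) M))
    (show E from u.snd) (by exact hd) (mdifferentiableAt_fibreInclusion u.proj (show E from u.snd))
  let T : E →L[ℝ] E := coord 𝓘(ℝ, E) u₀.proj u.proj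
  have he : extChartAt 𝓘(ℝ, E).tangent u₀ ∘
      (fun w : E ↦ (TotalSpace.mk' E u.proj w : TangentBundle 𝓘(ℝ, E) M)) =
      fun w : E ↦ (extChartAt 𝓘(ℝ, E) u₀.proj u.proj, T w) := by
    funext w
    exact extChartAt_tangent (u := TotalSpace.mk' E u.proj w) hu
  rw [he, mfderiv_eq_fderiv, ((hasFDerivAt_const _ _).prodMk T.hasFDerivAt).fderiv] at h
  rw [coord_eq_mfderiv hu']
  exact (congrArg (fun L : E →L[ℝ] E × E ↦ L b) h).symm

/-- The derivative of the auxiliary section `σ` enters both $d\sigma$ and $\nabla\sigma$ and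
cancels, leaving only the Christoffel term. -/
theorem coord_horizontalLift (hD : HasChristoffel D u₀.proj Γ)
    (hu : u.proj ∈ (chartAt E u₀.proj).source) (a : TangentSpace 𝓘(ℝ, E) u.proj) :
    coord 𝓘(ℝ, E).tangent u₀ u (horizontalLift D u a) =
      (coord 𝓘(ℝ, E) u₀.proj u.proj a,
        -Γ (extChartAt 𝓘(ℝ, E) u₀.proj u.proj) (coord 𝓘(ℝ, E) u₀.proj u.proj a)
          (coord 𝓘(ℝ, E) u₀.proj u.proj u.snd)) := by
  have hu' := (TangentBundle.mem_chart_source_iff (I := 𝓘(ℝ, E)) u u₀).2 hu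
  have hd : MDifferentiableAt 𝓘(ℝ, E).tangent 𝓘(ℝ, E × E) (extChartAt 𝓘(ℝ, E).tangent u₀) u :=
    (contMDiffAt_chart (I := 𝓘(ℝ, E).tangent) hu').mdifferentiableAt (by simp)
  let σ : ∀ x : M, TangentSpace 𝓘(ℝ, E) x := FiberBundle.extend E u.snd
  let s : M → TangentBundle 𝓘(ℝ, E) M := fun x ↦ TotalSpace.mk' E x (σ x)
  have hs : MDifferentiableAt 𝓘(ℝ, E) 𝓘(ℝ, E).tangent s u.proj :=
    FiberBundle.mdifferentiableAt_extend ..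
  have hσu : σ u.proj = u.snd := by simp [σ]
  have hsu : s u.proj = u := by simp [s, σ]
  have h1 : coord 𝓘(ℝ, E).tangent u₀ u (mfderiv 𝓘(ℝ, E) 𝓘(ℝ, E).tangent s u.proj a) =
      (coord 𝓘(ℝ, E) u₀.proj u.proj a, fderiv ℝ (repField u₀.proj σ)
        (extChartAt 𝓘(ℝ, E) u₀.proj u.proj) (coord 𝓘(ℝ, E) u₀.proj u.proj a)) := by
    have hd' : MDifferentiableAt 𝓘(ℝ, E).tangent 𝓘(ℝ, E × E) (extChartAt 𝓘(ℝ, E).tangent u₀)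
      (s u.proj) := by rw [hsu]; exact hd
    have hcomp := hd'.comp u.proj hs
    have h := mfderiv_comp (I'' := 𝓘(ℝ, E × E)) u.proj hd' hs
    have h' := mvfderiv_eq_fderiv hu hcomp a
    have he : (fun z ↦ (extChartAt 𝓘(ℝ, E).tangent u₀ ∘ s) ((extChartAt 𝓘(ℝ, E) u₀.proj).symm z))
        =ᶠ[𝓝 (extChartAt 𝓘(ℝ, E) u₀.proj u.proj)] fun z ↦ (z, repField u₀.proj σ z) := by
      filter_upwards [(isOpen_extChartAt_target (I := 𝓘(ℝ, E)) u₀.proj).mem_nhds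
        (extChartAt_mem_target hu)] with z hz
      refine (extChartAt_tangent (u := s ((extChartAt 𝓘(ℝ, E) u₀.proj).symm z))
        (extChartAt_symm_source hz)).trans ?_
      exact Prod.ext ((extChartAt 𝓘(ℝ, E) u₀.proj).right_inv hz) rfl
    rw [he.fderiv_eq] at h'
    replace h' := h'.trans (congrArg (fun L : E →L[ℝ] E × E ↦ L (coord 𝓘(ℝ, E) u₀.proj u.proj a))
      ((hasFDerivAt_id _).prodMk (differentiableAt_repField hu hs).hasFDerivAt).fderiv)
    have h'' : mfderiv 𝓘(ℝ, E).tangent 𝓘(ℝ, E × E) (extChartAt 𝓘(ℝ, E).tangent u₀) (s u.proj)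
      (mfderiv 𝓘(ℝ, E) 𝓘(ℝ, E).tangent s u.proj a) = _ :=
      (congrArg (fun L : E →L[ℝ] E × E ↦ L a) h).symm.trans h'
    rw [coord_eq_mfderiv hu']
    -- `s u.proj` equals `u` only propositionally; viewing the tangent vector in `E × E` allows the
    -- base point to be changed.
    let X : E × E := mfderiv 𝓘(ℝ, E) 𝓘(ℝ, E).tangent s u.proj a
    let P : TangentBundle 𝓘(ℝ, E) M → E × E → E × E := fun q ↦
      mfderiv 𝓘(ℝ, E).tangent 𝓘(ℝ, E × E) (extChartAt 𝓘(ℝ, E).tangent u₀) q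
    exact (congrArg (fun q ↦ P q X) hsu.symm).trans h''
  have h2 := hD u.proj hu σ hs a
  rw [hσu] at h2
  have h3 : coord 𝓘(ℝ, E).tangent u₀ u (horizontalLift D u a) =
      coord 𝓘(ℝ, E).tangent u₀ u (mfderiv 𝓘(ℝ, E) 𝓘(ℝ, E).tangent s u.proj a) -
        coord 𝓘(ℝ, E).tangent u₀ u (verticalLift u (D σ u.proj a)) := map_sub _ _ _
  rw [h3, h1, coord_verticalLift hu, h2]
  simp

theorem liftSum_parts (D : Connection 𝓘(ℝ, E) M) (u : TangentBundle 𝓘(ℝ, E) M)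
    (V : TangentSpace 𝓘(ℝ, E).tangent u) :
    horizontalLift D u (parts D u V).1 + verticalLift u (parts D u V).2 = V :=
  (liftSum_isInvertible D u).self_apply_inverse V

/-- The coordinate expression of the horizontal and vertical parts. -/
theorem coordParts_coord (hD : HasChristoffel D u₀.proj Γ)
    (hu : u.proj ∈ (chartAt E u₀.proj).source) (V : TangentSpace 𝓘(ℝ, E).tangent u) :
    coordParts Γ (extChartAt 𝓘(ℝ, E).tangent u₀ u) (coord 𝓘(ℝ, E).tangent u₀ u V) =
      (coord 𝓘(ℝ, E) u₀.proj u.proj (parts D u V).1,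
        coord 𝓘(ℝ, E) u₀.proj u.proj (parts D u V).2) := by
  have h : coord 𝓘(ℝ, E).tangent u₀ u V =
      coord 𝓘(ℝ, E).tangent u₀ u (horizontalLift D u (parts D u V).1) +
        coord 𝓘(ℝ, E).tangent u₀ u (verticalLift u (parts D u V).2) := by
    rw [← map_add, liftSum_parts]
  rw [h, coord_verticalLift hu, coord_horizontalLift hD hu, coordParts_apply,
    extChartAt_tangent hu]
  simp

/-- Reduces the coordinate matrix of any lifted endomorphism to its action `S` on horizontal and
vertical parts. -/
theorem repEnd_lift (hD : HasChristoffel D u₀.proj Γ)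
    {K : EndField 𝓘(ℝ, E).tangent (TangentBundle 𝓘(ℝ, E) M)}
    {S : E × E → E × E →L[ℝ] E × E}
    (hS : ∀ u : TangentBundle 𝓘(ℝ, E) M, u.proj ∈ (chartAt E u₀.proj).source →
      ∀ V, (coord 𝓘(ℝ, E) u₀.proj u.proj (parts D u (K u V)).1,
        coord 𝓘(ℝ, E) u₀.proj u.proj (parts D u (K u V)).2) =
        S (extChartAt 𝓘(ℝ, E).tangent u₀ u) (coord 𝓘(ℝ, E) u₀.proj u.proj (parts D u V).1,
          coord 𝓘(ℝ, E) u₀.proj u.proj (parts D u V).2))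
    {p : E × E} (hp : p ∈ (extChartAt 𝓘(ℝ, E).tangent u₀).target) :
    repEnd u₀ K p = liftEnd Γ S p := by
  obtain ⟨u, hu', rfl⟩ : ∃ u ∈ (chartAt (ModelProd E E) u₀).source,
      extChartAt 𝓘(ℝ, E).tangent u₀ u = p :=
    ⟨_, extChartAt_symm_source hp, (extChartAt 𝓘(ℝ, E).tangent u₀).right_inv hp⟩
  have hu := (TangentBundle.mem_chart_source_iff (I := 𝓘(ℝ, E)) u u₀).1 hu'
  refine ContinuousLinearMap.ext fun W ↦ ?_
  rw [← coord_coordSymm (I := 𝓘(ℝ, E).tangent) hu' W, repEnd_chart_coord hu']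
  rw [← coordPartsSymm_coordParts Γ _ (coord 𝓘(ℝ, E).tangent u₀ u (K u _)),
    coordParts_coord hD hu, hS u hu, ← coordParts_coord hD hu]
  rfl

theorem parts_liftJ₁ (D : Connection 𝓘(ℝ, E) M) (J : EndField 𝓘(ℝ, E) M)
    (u : TangentBundle 𝓘(ℝ, E) M) (V : TangentSpace 𝓘(ℝ, E).tangent u) :
    parts D u (liftJ₁ D J u V) = (-J u.proj (parts D u V).1, J u.proj (parts D u V).2) := by
  nth_rewrite 1 [← liftSum_parts D u V]
  rw [map_add, liftJ₁_horizontal, liftJ₁_vertical, map_add, map_neg, parts_horizontal,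
    parts_vertical]
  simp

theorem parts_liftJ₂ (D : Connection 𝓘(ℝ, E) M)
    (u : TangentBundle 𝓘(ℝ, E) M) (V : TangentSpace 𝓘(ℝ, E).tangent u) :
    parts D u (liftJ₂ D u V) = (-(parts D u V).2, (parts D u V).1) := by
  nth_rewrite 1 [← liftSum_parts D u V]
  rw [map_add, liftJ₂_horizontal, liftJ₂_vertical, map_add, map_neg, parts_horizontal,
    parts_vertical]
  simp

theorem parts_liftJ₃ (D : Connection 𝓘(ℝ, E) M) (J : EndField 𝓘(ℝ, E) M)
    (u : TangentBundle 𝓘(ℝ, E) M) (V : TangentSpace 𝓘(ℝ, E).tangent u) :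
    parts D u (liftJ₃ D J u V) = (J u.proj (parts D u V).2, J u.proj (parts D u V).1) := by
  nth_rewrite 1 [← liftSum_parts D u V]
  rw [map_add, liftJ₃_horizontal, liftJ₃_vertical, map_add, parts_horizontal,
    parts_vertical]
  simp

theorem parts_injective (D : Connection 𝓘(ℝ, E) M) (u : TangentBundle 𝓘(ℝ, E) M) :
    Function.Injective (parts D u) := by
  intro V W h
  rw [← liftSum_parts D u V, h, liftSum_parts]

theorem repEnd_liftJ₁ (hD : HasChristoffel D u₀.proj Γ) (J : EndField 𝓘(ℝ, E) M)
    {p : E × E} (hp : p ∈ (extChartAt 𝓘(ℝ, E).tangent u₀).target) :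
    repEnd u₀ (liftJ₁ D J) p = liftEnd Γ (fun q ↦ frameJ₁ (repEnd u₀.proj J q.1)) p := by
  refine repEnd_lift hD (fun u hu V ↦ ?_) hp
  rw [parts_liftJ₁, extChartAt_tangent hu, frameJ₁_apply, repEnd_chart_coord hu,
    repEnd_chart_coord hu, map_neg]

theorem repEnd_liftJ₂ (hD : HasChristoffel D u₀.proj Γ)
    {p : E × E} (hp : p ∈ (extChartAt 𝓘(ℝ, E).tangent u₀).target) :
    repEnd u₀ (liftJ₂ D) p = liftEnd Γ (fun _ ↦ frameJ₂) p := by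
  refine repEnd_lift hD (fun u hu V ↦ ?_) hp
  rw [parts_liftJ₂, frameJ₂_apply, map_neg]

theorem repEnd_liftJ₃ (hD : HasChristoffel D u₀.proj Γ) (J : EndField 𝓘(ℝ, E) M)
    {p : E × E} (hp : p ∈ (extChartAt 𝓘(ℝ, E).tangent u₀).target) :
    repEnd u₀ (liftJ₃ D J) p = liftEnd Γ (fun q ↦ frameJ₃ (repEnd u₀.proj J q.1)) p := by
  refine repEnd_lift hD (fun u hu V ↦ ?_) hp
  rw [parts_liftJ₃, extChartAt_tangent hu, frameJ₃_apply, repEnd_chart_coord hu,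
    repEnd_chart_coord hu]

/-- Replacing each vertical part by $b+\Gamma(a,w)$ produces two Christoffel terms, whose sum is
$\partial_w g$ by compatibility. -/
theorem repForm_completeLift {g : FormField 𝓘(ℝ, E) M} (hg : IsPseudoRiemannian g)
    (hD : HasChristoffel D u₀.proj Γ)
    (hΓ : ∀ z ∈ (extChartAt 𝓘(ℝ, E) u₀.proj).target, IsChristoffel (repForm u₀.proj g) Γ z)
    {p : E × E} (hp : p ∈ (extChartAt 𝓘(ℝ, E).tangent u₀).target) :
    repForm u₀ (completeLift D g) p = liftMetric (repForm u₀.proj g) p := by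
  have hΓp := hΓ p.1 (mem_extChartAt_tangent_target.1 hp)
  have hs := repForm_symm (x₀ := u₀.proj) hg p.1
  obtain ⟨u, hu', rfl⟩ : ∃ u ∈ (chartAt (ModelProd E E) u₀).source,
      extChartAt 𝓘(ℝ, E).tangent u₀ u = p :=
    ⟨_, extChartAt_symm_source hp, (extChartAt 𝓘(ℝ, E).tangent u₀).right_inv hp⟩
  have hu := (TangentBundle.mem_chart_source_iff (I := 𝓘(ℝ, E)) u u₀).1 hu'
  refine ContinuousLinearMap.ext fun V ↦ ContinuousLinearMap.ext fun W ↦ ?_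
  rw [← coord_coordSymm (I := 𝓘(ℝ, E).tangent) hu' V,
    ← coord_coordSymm (I := 𝓘(ℝ, E).tangent) hu' W, repForm_chart_coord hu', completeLift_apply,
    ← repForm_chart_coord hu, ← repForm_chart_coord hu]
  have hV := coordParts_coord hD hu (coordSymm 𝓘(ℝ, E).tangent u₀ u V)
  have hW := coordParts_coord hD hu (coordSymm 𝓘(ℝ, E).tangent u₀ u W)
  rw [coord_coordSymm hu', coordParts_apply, Prod.mk.injEq] at hV hW
  have he : (extChartAt 𝓘(ℝ, E).tangent u₀ u).1 = extChartAt 𝓘(ℝ, E) u₀.proj u.proj :=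
    congrArg Prod.fst (extChartAt_tangent hu)
  rw [coord_coordSymm hu', coord_coordSymm hu', ← hV.1, ← hV.2, ← hW.1, ← hW.2, liftMetric_apply,
    hΓp.compat, hΓp.symm _ V.1, hΓp.symm _ W.1, he]
  simp only [map_add, add_apply]
  ring

end TangentCoordinates

/-! ### Coordinate criteria for the Levi-Civita connection. -/

section Criteria

variable {F : Type*} [NormedAddCommGroup F] [NormedSpace ℝ F] [FiniteDimensional ℝ F]
  {H : Type*} [TopologicalSpace H] {I : ModelWithCorners ℝ F H} [I.Boundaryless]
  {N : Type*} [TopologicalSpace N] [ChartedSpace H N] [IsManifold I ∞ N] {g : FormField I N}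

theorem hasChristoffel_leviCivita (hg : IsPseudoRiemannian g) (x₀ : N) :
    HasChristoffel (leviCivita g) x₀ (christoffel (repForm x₀ g)) :=
  hasChristoffel_of_isChristoffel hg fun _ hz ↦ isChristoffel_repForm hg hz

theorem isFlat_iff_coord (hg : IsPseudoRiemannian g) :
    IsFlat (leviCivita g) ↔ ∀ x₀ : N, ∀ z ∈ (extChartAt I x₀).target, ∀ a b c,
      coordCurvature (christoffel (repForm x₀ g)) z a b c = 0 :=
  ⟨fun h x₀ _ hz ↦ h.coordCurvature_eq_zero (hasChristoffel_leviCivita hg x₀)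
    (contDiffOn_christoffel_repForm hg x₀) hz,
  fun h ↦ isFlat_of_coordCurvature fun x₀ ↦ ⟨_, hasChristoffel_leviCivita hg x₀,
    contDiffOn_christoffel_repForm hg x₀, h x₀ _ (mem_extChartAt_target x₀)⟩⟩

theorem isParallel_iff_coord (hg : IsPseudoRiemannian g) {J : EndField I N} (hJ : SmoothEnd J) :
    IsParallel (leviCivita g) J ↔ ∀ x₀ : N, ∀ z ∈ (extChartAt I x₀).target, ∀ a b,
      coordDerivEnd (christoffel (repForm x₀ g)) (repEnd x₀ J) z a b = 0 :=
  ⟨fun h x₀ _ hz ↦ h.coordDerivEnd_eq_zero (hasChristoffel_leviCivita hg x₀) hJ hz,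
  fun h ↦ isParallel_of_coordDerivEnd hJ fun x₀ ↦ ⟨_, hasChristoffel_leviCivita hg x₀,
    h x₀ _ (mem_extChartAt_target x₀)⟩⟩

theorem coordDerivEnd_congr {Γ : F → F →L[ℝ] F →L[ℝ] F} {J K : F → F →L[ℝ] F} {z : F}
    (h : J =ᶠ[𝓝 z] K) (a b : F) : coordDerivEnd Γ J z a b = coordDerivEnd Γ K z a b := by
  rw [coordDerivEnd, coordDerivEnd, h.fderiv_eq, h.self_of_nhds]

theorem structureTensorVanishes_iff (hg : IsPseudoRiemannian g) (J : EndField I N) :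
    StructureTensorVanishes g J ↔ IsParallel (leviCivita g) J :=
  ⟨fun h x v Y hY ↦ hg.nondegenerate _ _ fun w ↦ h x v w Y hY,
    fun h x v w Y hY ↦ by rw [h x v Y hY, map_zero, zero_apply]⟩

end Criteria

/-! ### The lifted structures on $TM$ and their parallelism. -/

section TangentBundle

variable {E : Type*} [NormedAddCommGroup E] [NormedSpace ℝ E] [FiniteDimensional ℝ E]
  {M : Type*} [TopologicalSpace M] [ChartedSpace E M] [IsManifold 𝓘(ℝ, E) ∞ M]
  {g : FormField 𝓘(ℝ, E) M} {J : EndField 𝓘(ℝ, E) M}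

theorem tangent_target_eq (u₀ : TangentBundle 𝓘(ℝ, E) M) :
    (extChartAt 𝓘(ℝ, E).tangent u₀).target =
      (extChartAt 𝓘(ℝ, E) u₀.proj).target ×ˢ Set.univ := by
  ext p
  simp only [mem_extChartAt_tangent_target, Set.mem_prod, Set.mem_univ, and_true]

/-- The complete lift of a pseudo-Riemannian metric is a pseudo-Riemannian metric. -/
theorem isPseudoRiemannian_completeLift (hg : IsPseudoRiemannian g) :
    IsPseudoRiemannian (completeLift (leviCivita g) g) where
  smooth := by
    refine smoothForm_of_repForm fun u₀ ↦ ?_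
    have hmem := extChartAt_target_mem_nhds (I := 𝓘(ℝ, E).tangent) u₀
    have h := contDiffOn_liftMetric (isOpen_extChartAt_target (I := 𝓘(ℝ, E)) u₀.proj)
      (contDiffOn_repForm hg.smooth u₀.proj)
    rw [← tangent_target_eq] at h
    refine (h.contDiffAt hmem).congr_of_eventuallyEq ?_
    filter_upwards [hmem] with p hp
    exact repForm_completeLift hg (hasChristoffel_leviCivita hg u₀.proj)
      (fun _ hz ↦ isChristoffel_repForm hg hz) hp
  symm u V W := by
    rw [completeLift_apply, completeLift_apply, hg.symm _ (parts _ u V).1,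
      hg.symm _ (parts _ u V).2, add_comm]
  nondegenerate u V h := by
    refine parts_injective (leviCivita g) u ?_
    rw [map_zero]
    refine Prod.ext (hg.nondegenerate _ _ fun w ↦ ?_) (hg.nondegenerate _ _ fun w ↦ ?_)
    · have := h (verticalLift u w)
      rw [completeLift_apply, parts_vertical] at this
      simpa using this
    · have := h (horizontalLift (leviCivita g) u w)
      rw [completeLift_apply, parts_horizontal] at this
      simpa using this

/-- The lifted symbols solve the Christoffel equations of $\widehat g$, and uniqueness identifies
them with its Levi-Civita connection. -/
theorem hasChristoffel_completeLift (hg : IsPseudoRiemannian g)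
    (u₀ : TangentBundle 𝓘(ℝ, E) M) :
    HasChristoffel (leviCivita (completeLift (leviCivita g) g)) u₀
      (liftChristoffel (christoffel (repForm u₀.proj g))) := by
  refine hasChristoffel_of_isChristoffel (isPseudoRiemannian_completeLift hg) fun p hp ↦ ?_
  have h := isChristoffel_lift (isOpen_extChartAt_target (I := 𝓘(ℝ, E)) u₀.proj)
    (contDiffOn_repForm hg.smooth u₀.proj) (contDiffOn_christoffel_repForm hg u₀.proj)
    (fun _ hz ↦ isChristoffel_repForm hg hz) (mem_extChartAt_tangent_target.1 hp)
  have he : repForm u₀ (completeLift (leviCivita g) g) =ᶠ[𝓝 p]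
      liftMetric (repForm u₀.proj g) := by
    filter_upwards [(isOpen_extChartAt_target u₀).mem_nhds hp] with q hq
    exact repForm_completeLift hg (hasChristoffel_leviCivita hg u₀.proj)
      (fun _ hz ↦ isChristoffel_repForm hg hz) hq
  exact ⟨h.symm, fun a b c ↦ by rw [he.fderiv_eq, he.self_of_nhds, h.compat]⟩

theorem smoothEnd_lift (hg : IsPseudoRiemannian g)
    {K : EndField 𝓘(ℝ, E).tangent (TangentBundle 𝓘(ℝ, E) M)} {S : M → E × E → E × E →L[ℝ] E × E}
    (hS : ∀ x₀, ContDiffOn ℝ ∞ (S x₀) ((extChartAt 𝓘(ℝ, E) x₀).target ×ˢ Set.univ))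
    (hK : ∀ u₀ : TangentBundle 𝓘(ℝ, E) M, ∀ p ∈ (extChartAt 𝓘(ℝ, E).tangent u₀).target,
      repEnd u₀ K p = liftEnd (christoffel (repForm u₀.proj g)) (S u₀.proj) p) :
    SmoothEnd K := by
  refine smoothEnd_of_repEnd fun u₀ ↦ ?_
  have hmem := extChartAt_target_mem_nhds (I := 𝓘(ℝ, E).tangent) u₀
  have h := contDiffOn_liftEnd (contDiffOn_christoffel_repForm hg u₀.proj) (hS u₀.proj)
  rw [← tangent_target_eq] at h
  refine (h.contDiffAt hmem).congr_of_eventuallyEq ?_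
  filter_upwards [hmem] with p hp using hK u₀ p hp

/-- Transfers parallelism on $TM$ to the model computation, with one condition per chart of $M$:
induced charts depend only on the base point. -/
theorem isParallel_lift_iff (hg : IsPseudoRiemannian g)
    {K : EndField 𝓘(ℝ, E).tangent (TangentBundle 𝓘(ℝ, E) M)} {S : M → E × E → E × E →L[ℝ] E × E}
    (hS : ∀ x₀, ContDiffOn ℝ ∞ (S x₀) ((extChartAt 𝓘(ℝ, E) x₀).target ×ˢ Set.univ))
    (hK : ∀ u₀ : TangentBundle 𝓘(ℝ, E) M, ∀ p ∈ (extChartAt 𝓘(ℝ, E).tangent u₀).target,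
      repEnd u₀ K p = liftEnd (christoffel (repForm u₀.proj g)) (S u₀.proj) p) :
    IsParallel (leviCivita (completeLift (leviCivita g) g)) K ↔
      ∀ x₀ : M, ∀ p : E × E, p.1 ∈ (extChartAt 𝓘(ℝ, E) x₀).target → ∀ V W,
        coordDerivEnd (liftChristoffel (christoffel (repForm x₀ g)))
          (liftEnd (christoffel (repForm x₀ g)) (S x₀)) p V W = 0 := by
  have hKs := smoothEnd_lift hg hS hK
  have he (u₀ : TangentBundle 𝓘(ℝ, E) M) {p : E × E}
      (hp : p ∈ (extChartAt 𝓘(ℝ, E).tangent u₀).target) : repEnd u₀ K =ᶠ[𝓝 p]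
      liftEnd (christoffel (repForm u₀.proj g)) (S u₀.proj) := by
    filter_upwards [(isOpen_extChartAt_target u₀).mem_nhds hp] with q hq using hK u₀ q hq
  constructor
  · intro h x₀ p hp V W
    -- The induced chart at the zero vector already covers the whole of $TM$ over the chart at `x₀`.
    have hp' := (mem_extChartAt_tangent_target
      (u₀ := (TotalSpace.mk' E x₀ 0 : TangentBundle 𝓘(ℝ, E) M))).2 hp
    rw [← coordDerivEnd_congr (he _ hp')]
    exact h.coordDerivEnd_eq_zero (hasChristoffel_completeLift hg _) hKs hp' V W
  · intro h
    refine isParallel_of_coordDerivEnd hKs fun u₀ ↦ ⟨_, hasChristoffel_completeLift hg u₀, ?_⟩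
    intro V W
    have hp := mem_extChartAt_target (I := 𝓘(ℝ, E).tangent) u₀
    rw [coordDerivEnd_congr (he u₀ hp)]
    exact h _ _ (mem_extChartAt_tangent_target.1 hp) V W

theorem repEnd_sq (hJ : IsAlmostComplex J) {x₀ : M} {z : E}
    (hz : z ∈ (extChartAt 𝓘(ℝ, E) x₀).target) (a : E) :
    repEnd x₀ J z (repEnd x₀ J z a) = -a := by
  have hx := extChartAt_symm_source hz
  rw [repEnd_apply, repEnd_apply, coordSymm_coord hx, hJ.sq, map_neg, coord_coordSymm hx]

theorem repEnd_eq_zero (hJ : IsAlmostComplex J) {x₀ : M} {z : E}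
    (hz : z ∈ (extChartAt 𝓘(ℝ, E) x₀).target) {a : E} (h : repEnd x₀ J z a = 0) : a = 0 := by
  rw [← neg_eq_zero, ← repEnd_sq hJ hz, h, map_zero]

theorem contDiffOn_frameJ₁_repEnd (hJ : SmoothEnd J) (x₀ : M) :
    ContDiffOn ℝ ∞ (fun p : E × E ↦ frameJ₁ (repEnd x₀ J p.1))
      ((extChartAt 𝓘(ℝ, E) x₀).target ×ˢ Set.univ) :=
  contDiffOn_frameJ₁ (contDiffOn_repEnd hJ x₀)

theorem contDiffOn_frameJ₃_repEnd (hJ : SmoothEnd J) (x₀ : M) :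
    ContDiffOn ℝ ∞ (fun p : E × E ↦ frameJ₃ (repEnd x₀ J p.1))
      ((extChartAt 𝓘(ℝ, E) x₀).target ×ˢ Set.univ) :=
  contDiffOn_frameJ₃ (contDiffOn_repEnd hJ x₀)

theorem isAlmostComplex_liftJ₁ (hg : IsPseudoRiemannian g) (hJ : IsAlmostComplex J) :
    IsAlmostComplex (liftJ₁ (leviCivita g) J) where
  smooth := smoothEnd_lift hg (contDiffOn_frameJ₁_repEnd hJ.smooth)
    fun u₀ _ hp ↦ repEnd_liftJ₁ (hasChristoffel_leviCivita hg u₀.proj) J hp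
  sq u V := by
    refine parts_injective (leviCivita g) u ?_
    rw [parts_liftJ₁, parts_liftJ₁, map_neg (parts (leviCivita g) u), map_neg, hJ.sq, hJ.sq,
      neg_neg]
    simp [Prod.ext_iff]

theorem isAlmostComplex_liftJ₂ (hg : IsPseudoRiemannian g) :
    IsAlmostComplex (liftJ₂ (leviCivita g)) where
  smooth := smoothEnd_lift hg (fun _ ↦ contDiffOn_const)
    fun u₀ _ hp ↦ repEnd_liftJ₂ (hasChristoffel_leviCivita hg u₀.proj) hp
  sq u V := by
    refine parts_injective (leviCivita g) u ?_
    rw [parts_liftJ₂, parts_liftJ₂, map_neg (parts (leviCivita g) u)]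
    simp [Prod.ext_iff]

theorem isAlmostComplex_liftJ₃ (hg : IsPseudoRiemannian g) (hJ : IsAlmostComplex J) :
    IsAlmostComplex (liftJ₃ (leviCivita g) J) where
  smooth := smoothEnd_lift hg (contDiffOn_frameJ₃_repEnd hJ.smooth)
    fun u₀ _ hp ↦ repEnd_liftJ₃ (hasChristoffel_leviCivita hg u₀.proj) J hp
  sq u V := by
    refine parts_injective (leviCivita g) u ?_
    rw [parts_liftJ₃, parts_liftJ₃, map_neg (parts (leviCivita g) u), hJ.sq, hJ.sq]
    simp [Prod.ext_iff]

theorem isParallel_liftJ₂_iff (hg : IsPseudoRiemannian g) :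
    IsParallel (leviCivita (completeLift (leviCivita g) g)) (liftJ₂ (leviCivita g)) ↔
      IsFlat (leviCivita g) := by
  rw [isParallel_lift_iff hg (S := fun _ _ ↦ frameJ₂) (fun _ ↦ contDiffOn_const)
    fun u₀ _ hp ↦ repEnd_liftJ₂ (hasChristoffel_leviCivita hg u₀.proj) hp, isFlat_iff_coord hg]
  have key (x₀ : M) {p : E × E} (hp : p.1 ∈ (extChartAt 𝓘(ℝ, E) x₀).target) :=
    coordDerivEnd_liftJ₂ (isOpen_extChartAt_target x₀) (contDiffOn_christoffel_repForm hg x₀)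
      (fun _ hz ↦ (isChristoffel_repForm hg hz).symm) hp
  -- The fibre coordinate is the first argument of the curvature, so letting it be any `a` recovers
  -- the whole tensor.
  exact ⟨fun h x₀ z hz a ↦ (key x₀ (p := (z, a)) hz).1 (h x₀ _ hz),
    fun h x₀ p hp ↦ (key x₀ hp).2 (h x₀ _ hp p.2)⟩

theorem coordCurvature_repEnd (hg : IsPseudoRiemannian g) (hJ : SmoothEnd J) {x₀ : M}
    (h : ∀ z ∈ (extChartAt 𝓘(ℝ, E) x₀).target, ∀ a b,
      coordDerivEnd (christoffel (repForm x₀ g)) (repEnd x₀ J) z a b = 0)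
    {z : E} (hz : z ∈ (extChartAt 𝓘(ℝ, E) x₀).target) (a b c : E) :
    coordCurvature (christoffel (repForm x₀ g)) z a b (repEnd x₀ J z c) =
      repEnd x₀ J z (coordCurvature (christoffel (repForm x₀ g)) z a b c) := by
  have hmem := (isOpen_extChartAt_target (I := 𝓘(ℝ, E)) x₀).mem_nhds hz
  refine coordCurvature_comm
    (((contDiffOn_christoffel_repForm hg x₀).contDiffAt hmem).differentiableAt (by simp))
    ((contDiffOn_repEnd hJ x₀).contDiffAt hmem) ?_ a b c
  filter_upwards [hmem] with y hy using h y hy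

/-- The anticommutation $RJ+JR=0$ alone does not give flatness; combined with the commutation
implied by $\nabla J=0$ it does. -/
theorem isParallel_liftJ₁_iff (hg : IsPseudoRiemannian g) (hJ : IsAlmostComplex J) :
    IsParallel (leviCivita (completeLift (leviCivita g) g)) (liftJ₁ (leviCivita g) J) ↔
      IsFlat (leviCivita g) ∧ IsParallel (leviCivita g) J := by
  rw [isParallel_lift_iff hg (contDiffOn_frameJ₁_repEnd hJ.smooth)
    fun u₀ _ hp ↦ repEnd_liftJ₁ (hasChristoffel_leviCivita hg u₀.proj) J hp, isFlat_iff_coord hg,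
    isParallel_iff_coord hg hJ.smooth]
  have key (x₀ : M) {p : E × E} (hp : p.1 ∈ (extChartAt 𝓘(ℝ, E) x₀).target) :=
    coordDerivEnd_liftJ₁ (isOpen_extChartAt_target x₀) (contDiffOn_christoffel_repForm hg x₀)
      (fun _ hz ↦ (isChristoffel_repForm hg hz).symm) (contDiffOn_repEnd hJ.smooth x₀) hp
  constructor
  · intro h
    have hpar : ∀ x₀ : M, ∀ z ∈ (extChartAt 𝓘(ℝ, E) x₀).target, ∀ a b,
        coordDerivEnd (christoffel (repForm x₀ g)) (repEnd x₀ J) z a b = 0 := fun x₀ z hz ↦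
      ((key x₀ (p := (z, 0)) hz).1 (h x₀ _ hz)).1
    refine ⟨fun x₀ z hz a b c ↦ ?_, hpar⟩
    have h1 := ((key x₀ (p := (z, a)) hz).1 (h x₀ _ hz)).2 b c
    -- Commutation turns $RJ+JR=0$ into $2JR=0$.
    rw [coordCurvature_repEnd hg hJ.smooth (hpar x₀) hz, ← two_smul ℝ, smul_eq_zero] at h1
    exact repEnd_eq_zero hJ hz (h1.resolve_left two_ne_zero)
  · rintro ⟨hflat, hpar⟩ x₀ p hp
    refine (key x₀ hp).2 ⟨hpar x₀ _ hp, fun c a ↦ ?_⟩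
    rw [hflat x₀ _ hp, hflat x₀ _ hp, map_zero, add_zero]

theorem isParallel_liftJ₃_iff (hg : IsPseudoRiemannian g) (hJ : IsAlmostComplex J) :
    IsParallel (leviCivita (completeLift (leviCivita g) g)) (liftJ₃ (leviCivita g) J) ↔
      IsFlat (leviCivita g) ∧ IsParallel (leviCivita g) J := by
  rw [isParallel_lift_iff hg (contDiffOn_frameJ₃_repEnd hJ.smooth)
    fun u₀ _ hp ↦ repEnd_liftJ₃ (hasChristoffel_leviCivita hg u₀.proj) J hp, isFlat_iff_coord hg,
    isParallel_iff_coord hg hJ.smooth]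
  have key (x₀ : M) {p : E × E} (hp : p.1 ∈ (extChartAt 𝓘(ℝ, E) x₀).target) :=
    coordDerivEnd_liftJ₃ (isOpen_extChartAt_target x₀) (contDiffOn_christoffel_repForm hg x₀)
      (fun _ hz ↦ (isChristoffel_repForm hg hz).symm) (contDiffOn_repEnd hJ.smooth x₀) hp
  constructor
  · intro h
    exact ⟨fun x₀ z hz a b c ↦ repEnd_eq_zero hJ hz
        (((key x₀ (p := (z, a)) hz).1 (h x₀ _ hz)).2.1 b c),
      fun x₀ z hz ↦ ((key x₀ (p := (z, 0)) hz).1 (h x₀ _ hz)).1⟩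
  · rintro ⟨hflat, hpar⟩ x₀ p hp
    refine (key x₀ hp).2 ⟨hpar x₀ _ hp, fun c a ↦ ?_, fun c a ↦ hflat x₀ _ hp _ _ _⟩
    rw [hflat x₀ _ hp, map_zero]

/-- The lifts form an almost hypercomplex Hermitian-Norden structure. -/
theorem isAlmostHypercomplexHermitianNorden_lift (hJg : IsAlmostNorden J g) :
    IsAlmostHypercomplexHermitianNorden (liftJ₁ (leviCivita g) J) (liftJ₂ (leviCivita g))
      (liftJ₃ (leviCivita g) J) (completeLift (leviCivita g) g) where
  hypercomplex :=
    { almostComplex₁ := isAlmostComplex_liftJ₁ hJg.metric hJg.almostComplex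
      almostComplex₂ := isAlmostComplex_liftJ₂ hJg.metric
      almostComplex₃ := isAlmostComplex_liftJ₃ hJg.metric hJg.almostComplex
      comp_eq := fun u V ↦ parts_injective (leviCivita g) u <| by
        simp [parts_liftJ₁, parts_liftJ₂, parts_liftJ₃]
      anticomm₁₂ := fun u V ↦ parts_injective (leviCivita g) u <| by
        simp [parts_liftJ₁, parts_liftJ₂]
      anticomm₂₃ := fun u V ↦ parts_injective (leviCivita g) u <| by
        simp [parts_liftJ₂, parts_liftJ₃]
      anticomm₃₁ := fun u V ↦ parts_injective (leviCivita g) u <| by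
        simp [parts_liftJ₁, parts_liftJ₃] }
  metric := isPseudoRiemannian_completeLift hJg.metric
  hermitian₁ u V W := by
    simp [completeLift_apply, parts_liftJ₁, hJg.anti_isometry]
  norden₂ u V W := by
    simp [completeLift_apply, parts_liftJ₂]
  norden₃ u V W := by
    simp [completeLift_apply, parts_liftJ₃, hJg.anti_isometry]

end TangentBundle

end NordenTangent

end

theorem mainTheorem9 {E : Type*} [NormedAddCommGroup E] [NormedSpace ℝ E] [FiniteDimensional ℝ E]
    {M : Type*} [TopologicalSpace M] [ChartedSpace E M] [IsManifold 𝓘(ℝ, E) ∞ M]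
    (J : NordenTangent.EndField 𝓘(ℝ, E) M) (g : NordenTangent.FormField 𝓘(ℝ, E) M)
    (hJg : NordenTangent.IsAlmostNorden J g) :
    let D : NordenTangent.Connection 𝓘(ℝ, E) M := NordenTangent.leviCivita g
    let J₁ := NordenTangent.liftJ₁ D J
    let J₂ := NordenTangent.liftJ₂ D
    let J₃ := NordenTangent.liftJ₃ D J
    let gHat := NordenTangent.completeLift D g
    let DHat : NordenTangent.Connection 𝓘(ℝ, E).tangent (TangentBundle 𝓘(ℝ, E) M) :=
      NordenTangent.leviCivita gHat
    -- (i)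
    ((NordenTangent.IsParallel DHat J₁ ↔
        NordenTangent.IsFlat D ∧ NordenTangent.IsParallel D J) ∧
      (NordenTangent.IsComplex J₁ ∧ NordenTangent.IsParallel DHat J₁ ↔
        NordenTangent.IsFlat D ∧ NordenTangent.IsParallel D J) ∧
      (NordenTangent.IsParallel DHat J₃ ↔
        NordenTangent.IsFlat D ∧ NordenTangent.IsParallel D J) ∧
      (NordenTangent.IsComplex J₃ ∧ NordenTangent.IsParallel DHat J₃ ↔
        NordenTangent.IsFlat D ∧ NordenTangent.IsParallel D J)) ∧
    -- (ii)
    ((NordenTangent.IsParallel DHat J₂ ↔ NordenTangent.IsFlat D) ∧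
      (NordenTangent.IsComplex J₂ ∧ NordenTangent.IsParallel DHat J₂ ↔
        NordenTangent.IsFlat D)) ∧
    -- (iii)
    (NordenTangent.IsPseudoHyperKahler J₁ J₂ J₃ gHat ↔
      NordenTangent.IsFlat D ∧ NordenTangent.IsParallel D J) := by
  intro D J₁ J₂ J₃ gHat DHat
  have hg := hJg.metric
  have hJ := hJg.almostComplex
  have hgHat := NordenTangent.isPseudoRiemannian_completeLift hg
  have h₁ := NordenTangent.isParallel_liftJ₁_iff hg hJ
  have h₂ := NordenTangent.isParallel_liftJ₂_iff hg
  have h₃ := NordenTangent.isParallel_liftJ₃_iff hg hJ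
  -- Parallelism already implies integrability, so the complex-structure conjunct is redundant.
  have c₁ : NordenTangent.IsParallel DHat J₁ → NordenTangent.IsComplex J₁ :=
    NordenTangent.isComplex_of_isParallel hgHat (NordenTangent.isAlmostComplex_liftJ₁ hg hJ)
  have c₂ : NordenTangent.IsParallel DHat J₂ → NordenTangent.IsComplex J₂ :=
    NordenTangent.isComplex_of_isParallel hgHat (NordenTangent.isAlmostComplex_liftJ₂ hg)
  have c₃ : NordenTangent.IsParallel DHat J₃ → NordenTangent.IsComplex J₃ :=
    NordenTangent.isComplex_of_isParallel hgHat (NordenTangent.isAlmostComplex_liftJ₃ hg hJ)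
  refine ⟨⟨h₁, (and_iff_right_of_imp c₁).trans h₁, h₃, (and_iff_right_of_imp c₃).trans h₃⟩,
    ⟨h₂, (and_iff_right_of_imp c₂).trans h₂⟩, fun h ↦ ?_, fun h ↦ ?_⟩
  -- Vanishing of $F_1$ alone already forces flatness and $\nabla J=0$.
  · exact h₁.1 ((NordenTangent.structureTensorVanishes_iff hgHat _).1 h.vanishes₁)
  · exact ⟨NordenTangent.isAlmostHypercomplexHermitianNorden_lift hJg,
      (NordenTangent.structureTensorVanishes_iff hgHat _).2 (h₁.2 h),
      (NordenTangent.structureTensorVanishes_iff hgHat _).2 (h₂.2 h.1),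
      (NordenTangent.structureTensorVanishes_iff hgHat _).2 (h₃.2 h)⟩
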